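/- Let $\mathcal H$ be a separable infinite-dimensional complex Hilbert space, let $U(\mathcal H)$ be its unitary group with the strong operator topology, and let $\pi\colon U(\mathcal H)\to PU(\mathcal H)=U(\mathcal H)/\{\zeta\cdot\mathrm{Id} : |\zeta|=1\}$ be the quotient map, where $PU(\mathcal H)$ has the quotient topology. Let $G$ be a compact Lie group. An $S^1$-central extension of $G$ is a short exact sequence of Lie groups $1\to S^1\to \widetilde G\xrightarrow{p} G\to 1$ in which the image of $S^1$ is central in $\widetilde G$. Two such extensions $\widetilde G_0,\widetilde G_1$ are isomorphic if there is an isomorphism of Lie groups $\phi\colon\widetilde G_0\to\widetilde G_1$ that is compatible with the inclusions of $S^1$ and with the projections to $G$. Let $\mathrm{Ext}(G,S^1)$ be the set of isomorphism classes $[\widetilde G]$. For a continuous homomorphism $\alpha\colon G\to PU(\mathcal H)$ put $$\widetilde G_\alpha=\{(g,T)\in G\times U(\mathcal H) : \alpha(g)=\pi(T)\},$$ with the subspace topology, with the inclusion $z\mapsto(1,z\cdot\mathrm{Id})$ of $S^1$, the projection $p(g,T)=g$ to $G$, and the homomorphism $\widetilde\alpha\colon\widetilde G_\alpha\to U(\mathcal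 H)$, $\widetilde\alpha(g,T)=T$. For an irreducible unitary representation $V$ of $\widetilde G_\alpha$, the isotypical component $\mathcal H^V_{\widetilde\alpha}$ is the image of the evaluation map $V\otimes\mathrm{Hom}_{\widetilde G_\alpha}(V,\mathcal H)\to\mathcal H$, where $\widetilde G_\alpha$ acts on $\mathcal H$ through $\widetilde\alpha$. The homomorphism $\alpha$ is called stable if $\mathcal H^V_{\widetilde\alpha}$ is infinite dimensional for every irreducible $V$ on which each $z\in S^1=\ker p$ acts as multiplication by $z$, and $\mathcal H^V_{\widetilde\alpha}=0$ for every other irreducible $V$. Let $\hom_{\mathrm{st}}(G,PU(\mathcal H))$ be the set of stable homomorphisms, and let $\hom_{\mathrm{st}}(G,PU(\mathcal H))/PU(\mathcal H)$ be the set of their conjugacy classes under $PU(\mathcal H)$. Then, for every stable $\alpha$, the group $\widetilde G_\alpha$ is an $S^1$-central extension of the Lie group $G$, and the map $\alpha\mapsto[\widetilde G_\alpha]$ induces a well-defined bijection $$\hom_{\mathrm{st}}(G,PU(\mathcal H))/PU(\mathcal H)\;\cong\;\mathrm{Ext}(G,S^1).$$ -/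

import Mathlib

open scoped Manifold ContDiff Topology

universe u v w

noncomputable section

namespace ProjUnitary

/-! ### The unitary group with the strong operator topology -/

/-- The group `U(H)` of unitary operators of `H`, i.e. of surjective linear isometries. -/
abbrev UH (H : Type v) [NormedAddCommGroup H] [InnerProductSpace ℂ H] : Type v := H ≃ₗᵢ[ℂ] H

section Unitary

variable {H : Type v} [NormedAddCommGroup H] [InnerProductSpace ℂ H]

/-- The strong operator topology on `U(H)`: the topology of pointwise norm convergence. -/
instance instTopologicalSpaceUH : TopologicalSpace (UH H) :=
  TopologicalSpace.induced (fun (T : UH H) (x : H) => T x) inferInstance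

theorem isInducing_UH : Topology.IsInducing (fun (T : UH H) (x : H) => T x) := ⟨rfl⟩

theorem continuous_UH_iff {X : Type*} [TopologicalSpace X] {f : X → UH H} :
    Continuous f ↔ ∀ x : H, Continuous fun a => f a x := by
  rw [isInducing_UH.continuous_iff, continuous_pi_iff]
  rfl

theorem continuous_UH_eval (x : H) : Continuous fun T : UH H => T x :=
  continuous_UH_iff.1 continuous_id x

instance instT2SpaceUH : T2Space (UH H) :=
  T2Space.of_injective_continuous (f := fun (T : UH H) (x : H) => T x)
    (fun _ _ h => LinearIsometryEquiv.ext fun x => congrFun h x) isInducing_UH.continuous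

instance instIsTopologicalGroupUH : IsTopologicalGroup (UH H) where
  continuous_mul := by
    rw [continuous_UH_iff]
    intro x
    rw [continuous_iff_continuousAt]
    rintro ⟨S, T⟩
    have h1 : Filter.Tendsto (fun p : UH H × UH H => p.2 x) (𝓝 (S, T)) (𝓝 (T x)) :=
      ((continuous_UH_eval x).comp continuous_snd).tendsto _
    have h2 : Filter.Tendsto (fun p : UH H × UH H => p.1 (T x)) (𝓝 (S, T)) (𝓝 (S (T x))) :=
      ((continuous_UH_eval (T x)).comp continuous_fst).tendsto _
    rw [tendsto_iff_dist_tendsto_zero] at h1 h2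
    change Filter.Tendsto (fun p : UH H × UH H => p.1 (p.2 x)) (𝓝 (S, T)) (𝓝 (S (T x)))
    rw [tendsto_iff_dist_tendsto_zero]
    refine squeeze_zero (fun _ => dist_nonneg) (fun p => ?_) (by simpa using h1.add h2)
    calc dist (p.1 (p.2 x)) (S (T x))
        ≤ dist (p.1 (p.2 x)) (p.1 (T x)) + dist (p.1 (T x)) (S (T x)) := dist_triangle _ _ _
      _ = dist (p.2 x) (T x) + dist (p.1 (T x)) (S (T x)) := by rw [p.1.dist_map]
  continuous_inv := by
    rw [continuous_UH_iff]
    intro x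
    rw [continuous_iff_continuousAt]
    intro S
    have h1 : Filter.Tendsto (fun T : UH H => T (S⁻¹ x)) (𝓝 S) (𝓝 (S (S⁻¹ x))) :=
      (continuous_UH_eval _).tendsto _
    have hS : S (S⁻¹ x) = x := S.apply_symm_apply x
    rw [tendsto_iff_dist_tendsto_zero] at h1
    change Filter.Tendsto (fun T : UH H => T⁻¹ x) (𝓝 S) (𝓝 (S⁻¹ x))
    rw [tendsto_iff_dist_tendsto_zero]
    refine h1.congr fun T => ?_
    have hT : T (T⁻¹ x) = x := T.apply_symm_apply x
    rw [hS, dist_comm, ← T.dist_map (T⁻¹ x) (S⁻¹ x), hT]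

/-- The homomorphism `S¹ → U(H)`, `z ↦ z • Id`. -/
def scalar (H : Type v) [NormedAddCommGroup H] [InnerProductSpace ℂ H] : Circle →* UH H where
  toFun z :=
    { toFun := fun x => (z : ℂ) • x
      invFun := fun x => ((z⁻¹ : Circle) : ℂ) • x
      map_add' := fun x y => smul_add _ x y
      map_smul' := fun c x => smul_comm _ c x
      left_inv := fun x => by simp [smul_smul]
      right_inv := fun x => by simp [smul_smul]
      norm_map' := fun x => by change ‖(z : ℂ) • x‖ = ‖x‖; rw [norm_smul, Circle.norm_coe, one_mul] }
  map_one' := by ext x; simp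
  map_mul' z w := by ext x; simp [mul_smul]

@[simp] theorem scalar_apply (z : Circle) (x : H) : scalar H z x = (z : ℂ) • x := rfl

theorem continuous_scalar : Continuous (scalar H) :=
  continuous_UH_iff.2 fun x => by
    simp only [scalar_apply]
    fun_prop

theorem scalar_comm (z : Circle) (T : UH H) : scalar H z * T = T * scalar H z := by
  ext x
  simp

theorem scalar_injective [Nontrivial H] : Function.Injective (scalar H) := by
  intro z w h
  obtain ⟨x, hx⟩ := exists_ne (0 : H)
  have := congrArg (fun T : UH H => T x) h
  simp only [scalar_apply] at this
  exact Circle.ext (smul_left_injective ℂ hx this)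

instance scalar_range_normal : (scalar H).range.Normal where
  conj_mem := by
    rintro _ ⟨z, rfl⟩ T
    exact ⟨z, by rw [← scalar_comm, mul_inv_cancel_right]⟩

end Unitary

/-- The projective unitary group `PU(H) = U(H) / {ζ • Id : |ζ| = 1}`, with the quotient topology. -/
abbrev PUH (H : Type v) [NormedAddCommGroup H] [InnerProductSpace ℂ H] : Type v :=
  UH H ⧸ (scalar H).range

/-! ### Circle central extensions -/

/-- A central extension `1 → S¹ → E → G → 1` of (Hausdorff) topological groups. -/
structure CircleExtension (G : Type u) [Group G] [TopologicalSpace G] : Type (max u (w + 1)) where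
  /-- The total group. -/
  E : Type w
  [group : Group E]
  [topologicalSpace : TopologicalSpace E]
  [isTopologicalGroup : IsTopologicalGroup E]
  [t2Space : T2Space E]
  /-- The underlying extension of abstract groups. -/
  ext : GroupExtension Circle E G
  isSES : TopologicalGroup.IsSES ext.inl ext.rightHom
  central : ∀ (z : Circle) (e : E), ext.inl z * e = e * ext.inl z

attribute [instance] CircleExtension.group CircleExtension.topologicalSpace
  CircleExtension.isTopologicalGroup CircleExtension.t2Space

namespace CircleExtension

/-- Isomorphism of circle central extensions of `G`: an isomorphism of topological groups which
commutes with the inclusions of `S¹` and with the projections to `G`. -/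
def Iso {G : Type u} [Group G] [TopologicalSpace G] (X Y : CircleExtension.{u, w} G) : Prop :=
  ∃ φ : X.ext.Equiv Y.ext, Continuous φ.toMulEquiv ∧ Continuous φ.toMulEquiv.symm

theorem Iso.equivalence {G : Type u} [Group G] [TopologicalSpace G] :
    Equivalence (Iso : CircleExtension.{u, w} G → CircleExtension.{u, w} G → Prop) where
  refl X := ⟨⟨MulEquiv.refl X.E, rfl, rfl⟩, continuous_id, continuous_id⟩
  symm := by
    rintro X Y ⟨φ, h1, h2⟩
    refine ⟨⟨φ.toMulEquiv.symm, ?_, ?_⟩, h2, h1⟩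
    · rw [← φ.inl_comm]
      funext z
      simp
    · rw [← φ.rightHom_comm]
      funext z
      simp
  trans := by
    rintro X Y Z ⟨φ, h1, h2⟩ ⟨ψ, h3, h4⟩
    refine ⟨⟨φ.toMulEquiv.trans ψ.toMulEquiv, ?_, ?_⟩, h3.comp h1, h2.comp h4⟩
    · rw [← ψ.inl_comm, ← φ.inl_comm]
      rfl
    · rw [← φ.rightHom_comm, ← ψ.rightHom_comm]
      rfl

/-- The extension is an extension of Lie groups: its total group carries a smooth structure that is
compatible with its topology and for which it is a Lie group and `S¹ → E` and `E → G` are smooth. -/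
def IsLie (n : ℕ) {G : Type u} [Group G] [TopologicalSpace G]
    [ChartedSpace (EuclideanSpace ℝ (Fin n)) G] (X : CircleExtension.{u, w} G) : Prop :=
  ∃ (m : ℕ) (_ : ChartedSpace (EuclideanSpace ℝ (Fin m)) X.E),
    LieGroup (𝓡 m) ∞ X.E ∧
    ContMDiff (𝓡 1) (𝓡 m) ∞ X.ext.inl ∧
    ContMDiff (𝓡 m) (𝓡 n) ∞ X.ext.rightHom

end CircleExtension

section Ext

variable (n : ℕ) (G : Type u) [Group G] [TopologicalSpace G]
  [ChartedSpace (EuclideanSpace ℝ (Fin n)) G]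

/-- The `S¹`-central extensions of the `n`-dimensional Lie group `G` by Lie groups. -/
abbrev LieCircleExtension : Type (max u (w + 1)) := {X : CircleExtension.{u, w} G // X.IsLie n}

/-- The isomorphism relation. The total groups are Lie groups, so the isomorphisms of topological
groups between them are the isomorphisms of Lie groups. -/
def LieCircleExtension.setoid : Setoid (LieCircleExtension.{u, w} n G) where
  r X Y := X.1.Iso Y.1
  iseqv := CircleExtension.Iso.equivalence.comap Subtype.val

/-- `Ext(G, S¹)`: the isomorphism classes of `S¹`-central extensions of the Lie group `G`. -/
def ExtClasses : Type (max u (w + 1)) := Quotient (LieCircleExtension.setoid.{u, w} n G)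

variable {G}

/-- The isomorphism class `[X]` in `Ext(G, S¹)` of an extension `X` of Lie groups. -/
def extClass (X : CircleExtension.{u, w} G) (hX : X.IsLie n) : ExtClasses.{u, w} n G :=
  Quotient.mk (LieCircleExtension.setoid.{u, w} n G) ⟨X, hX⟩

end Ext

/-! ### Unitary representations and isotypical components -/

/-- The linear representation on `H` defined by a homomorphism to `U(H)`. -/
def toRep {E : Type w} [Group E] {H : Type v} [NormedAddCommGroup H] [InnerProductSpace ℂ H]
    (α : E →* UH H) : Representation ℂ E H where
  toFun g := (α g).toLinearEquiv.toLinearMap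
  map_one' := by ext x; simp
  map_mul' g h := by ext x; simp

/-- An irreducible unitary representation of a compact topological group `E` (such representations
are finite dimensional); the space is a coordinate space, so that every isomorphism class of
irreducible representations occurs. -/
structure Irrep (E : Type w) [Group E] [TopologicalSpace E] where
  dim : ℕ
  hom : E →ₜ* UH (EuclideanSpace ℂ (Fin dim))
  irreducible : (toRep hom.toMonoidHom).IsIrreducible

/-- The isotypical component `H_α^V`: the image of the evaluation map `V ⊗ Hom_E(V, H_α) → H_α`,
i.e. the sum of the images of all `E`-equivariant linear maps `V → H_α`. -/
def isotypic {E : Type w} [Group E] [TopologicalSpace E]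
    {H : Type v} [NormedAddCommGroup H] [InnerProductSpace ℂ H]
    (α : E →ₜ* UH H) (V : Irrep E) : Submodule ℂ H :=
  ⨆ f : Representation.IntertwiningMap (toRep V.hom.toMonoidHom) (toRep α.toMonoidHom),
    LinearMap.range f.toLinearMap

/-- The set `S(X)` of the irreducible representations of the total group on which the kernel `S¹`
of the projection acts by multiplication. -/
def scalarIrreps {G : Type u} [Group G] [TopologicalSpace G] (X : CircleExtension.{u, w} G) :
    Set (Irrep X.E) :=
  {V | ∀ z : Circle, V.hom (X.ext.inl z) = scalar _ z}

/-- The homomorphism `α` belongs to `hom_st(E, U(H))_C`: the isotypical components of the members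
of `C` are infinite dimensional and all the others vanish. -/
def IsStableOn {E : Type w} [Group E] [TopologicalSpace E]
    {H : Type v} [NormedAddCommGroup H] [InnerProductSpace ℂ H]
    (α : E →ₜ* UH H) (C : Set (Irrep E)) : Prop :=
  (∀ V ∈ C, ¬ FiniteDimensional ℂ (isotypic α V)) ∧ ∀ V ∉ C, isotypic α V = ⊥

/-! ### Pullback extensions and stable homomorphisms -/

section Pullback

variable {G : Type u} [Group G] [TopologicalSpace G]
  {H : Type v} [NormedAddCommGroup H] [InnerProductSpace ℂ H]

/-- The pullback `G̃_α = {(g, T) ∈ G × U(H) : α(g) = π(T)}` of `U(H) → PU(H)` along `α`, with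
the subspace topology. -/
def pullbackGroup (α : G →ₜ* PUH H) : Subgroup (G × UH H) where
  carrier := {p | α p.1 = (p.2 : PUH H)}
  one_mem' := by simp
  mul_mem' := by
    intro p q hp hq
    simp only [Set.mem_ofPred_eq] at hp hq ⊢
    simp [hp, hq]
  inv_mem' := by
    intro p hp
    simp only [Set.mem_ofPred_eq] at hp ⊢
    simp [hp]

theorem mem_pullbackGroup {α : G →ₜ* PUH H} {p : G × UH H} :
    p ∈ pullbackGroup α ↔ α p.1 = (p.2 : PUH H) := Iff.rfl

theorem coe_scalar (z : Circle) : ((scalar H z : UH H) : PUH H) = 1 :=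
  (QuotientGroup.eq_one_iff _).2 ⟨z, rfl⟩

/-- The projection `G̃_α → G`. -/
def pullbackProj (α : G →ₜ* PUH H) : pullbackGroup α →* G :=
  (MonoidHom.fst G (UH H)).comp (pullbackGroup α).subtype

/-- The inclusion `S¹ → G̃_α`, `z ↦ (1, z • Id)`. -/
def pullbackIncl (α : G →ₜ* PUH H) : Circle →* pullbackGroup α :=
  ((MonoidHom.inr G (UH H)).comp (scalar H)).codRestrict _ fun z => by
    simp [mem_pullbackGroup, coe_scalar]

/-- The homomorphism `α̃ : G̃_α → U(H)`. -/
def lift (α : G →ₜ* PUH H) : pullbackGroup α →ₜ* UH H where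
  toMonoidHom := (MonoidHom.snd G (UH H)).comp (pullbackGroup α).subtype
  continuous_toFun := continuous_snd.comp continuous_subtype_val

theorem continuous_pullbackIncl (α : G →ₜ* PUH H) : Continuous (pullbackIncl α) :=
  Continuous.subtype_mk (continuous_const.prodMk continuous_scalar) _

theorem isOpenMap_pullbackProj (α : G →ₜ* PUH H) : IsOpenMap (pullbackProj α) := by
  rintro _ ⟨W, hW, rfl⟩
  rw [isOpen_iff_mem_nhds]
  rintro _ ⟨p, hp, rfl⟩
  obtain ⟨A, B, hA, hpA, hB, hpB, hAB⟩ := mem_nhds_prod_iff'.1 (hW.mem_nhds hp)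
  have hB' : IsOpen ((fun T : UH H => (T : PUH H)) '' B) :=
    QuotientGroup.isOpenMap_coe (N := (scalar H).range) B hB
  have hO : IsOpen (A ∩ α ⁻¹' ((fun T : UH H => (T : PUH H)) '' B)) :=
    hA.inter (hB'.preimage α.continuous_toFun)
  refine Filter.mem_of_superset (hO.mem_nhds ⟨hpA, p.1.2, hpB, (mem_pullbackGroup.1 p.2).symm⟩) ?_
  rintro g ⟨hgA, T, hTB, hT⟩
  exact ⟨⟨(g, T), mem_pullbackGroup.2 hT.symm⟩, hAB ⟨hgA, hTB⟩, rfl⟩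

theorem pullbackProj_surjective (α : G →ₜ* PUH H) : Function.Surjective (pullbackProj α) := by
  intro g
  obtain ⟨T, hT⟩ := QuotientGroup.mk_surjective (α g)
  exact ⟨⟨(g, T), mem_pullbackGroup.2 hT.symm⟩, rfl⟩

theorem pullbackIncl_injective [Nontrivial H] (α : G →ₜ* PUH H) :
    Function.Injective (pullbackIncl α) := by
  intro z w h
  exact scalar_injective (congrArg (fun p : pullbackGroup α => p.1.2) h)

theorem range_pullbackIncl (α : G →ₜ* PUH H) : (pullbackIncl α).range = (pullbackProj α).ker := by
  ext p
  constructor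
  · rintro ⟨z, rfl⟩
    rfl
  · intro hp
    have h1 : p.1.1 = 1 := hp
    have h2 := mem_pullbackGroup.1 p.2
    rw [h1, map_one] at h2
    obtain ⟨z, hz⟩ := (QuotientGroup.eq_one_iff _).1 h2.symm
    exact ⟨z, Subtype.ext (Prod.ext h1.symm hz)⟩

/-- The central extension `1 → S¹ → G̃_α → G → 1`. -/
def pullbackExtension [IsTopologicalGroup G] [T2Space G] [Nontrivial H] (α : G →ₜ* PUH H) :
    CircleExtension.{u, max u v} G where
  E := pullbackGroup α
  ext :=
    { inl := pullbackIncl α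
      rightHom := pullbackProj α
      inl_injective := pullbackIncl_injective α
      range_inl_eq_ker_rightHom := range_pullbackIncl α
      rightHom_surjective := pullbackProj_surjective α }
  isSES :=
    { isClosedEmbedding :=
        (continuous_pullbackIncl α).isClosedEmbedding (pullbackIncl_injective α)
      isOpenQuotientMap :=
        ⟨pullbackProj_surjective α, continuous_fst.comp continuous_subtype_val,
          isOpenMap_pullbackProj α⟩
      mulExact := fun p => by
        rw [← MonoidHom.mem_ker, ← range_pullbackIncl]
        rfl }
  central z p := Subtype.ext (Prod.ext ((one_mul _).trans (mul_one _).symm) (scalar_comm z p.1.2))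

/-- A continuous homomorphism `α : G → PU(H)` is stable if `α̃ : G̃_α → U(H)` belongs to
`hom_st(G̃_α, U(H))_C` for the set `C = S(G̃_α)`. -/
def IsStable [IsTopologicalGroup G] [T2Space G] [Nontrivial H] (α : G →ₜ* PUH H) : Prop :=
  IsStableOn (E := (pullbackExtension α).E) (lift α) (scalarIrreps (pullbackExtension α))

variable (G H)

/-- `hom_st(G, PU(H))`. -/
abbrev StableHom [IsTopologicalGroup G] [T2Space G] [Nontrivial H] : Type (max u v) :=
  {α : G →ₜ* PUH H // IsStable α}

/-- Conjugacy of stable homomorphisms under `PU(H)`. -/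
def StableHom.setoid [IsTopologicalGroup G] [T2Space G] [Nontrivial H] :
    Setoid (StableHom G H) where
  r α β := ∃ F : PUH H, ∀ g : G, F * α.1 g * F⁻¹ = β.1 g
  iseqv :=
    { refl := fun α => ⟨1, fun g => by simp⟩
      symm := by
        rintro α β ⟨F, hF⟩
        exact ⟨F⁻¹, fun g => by rw [← hF g]; group⟩
      trans := by
        rintro α β γ ⟨F, hF⟩ ⟨F', hF'⟩
        exact ⟨F' * F, fun g => by rw [← hF' g, ← hF g]; group⟩ }

/-- `hom_st(G, PU(H)) / PU(H)`: the conjugacy classes of stable homomorphisms. -/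
def StableClasses [IsTopologicalGroup G] [T2Space G] [Nontrivial H] : Type (max u v) :=
  Quotient (StableHom.setoid G H)

variable {G H}

/-- The conjugacy class of a stable homomorphism. -/
def conjClass [IsTopologicalGroup G] [T2Space G] [Nontrivial H] (α : StableHom G H) :
    StableClasses G H :=
  Quotient.mk (StableHom.setoid G H) α

end Pullback

end ProjUnitary

end

/-! The circle acts by scalars in the tautological representation α̃ of G̃_α. Stability says that α̃
contains each irreducible representation with scalar circle action infinitely often, and no other. A
unitary representation of a compact group is a Hilbert sum of irreducibles (`exists_decomposition`),
and on a separable space infinite multiplicity means countably infinite. So two representations that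
are stable for the same set are unitarily equivalent (`IsStableOn.exists_unitary`).

An isomorphism of extensions carries one stability condition to the other (`IsStableOn.of_iso`).
Hence isomorphic pullback extensions give a unitary intertwiner, whose class in PU(H) conjugates α
to β; this is injectivity. In the other direction, conjugation by a unitary lift of an element of
PU(H) identifies the pullback extensions, so the map is well defined.

For surjectivity, let E be an extension. The weight-one part of the left regular representation on
L²(E; H) is separable and infinite dimensional, hence a copy of H. Matrix coefficients tensored with
vectors of H embed every admissible irreducible infinitely often, and the weight condition excludes
the others (`CircleExtension.exists_isStableOn`). Dividing by scalars gives α, and E is recovered as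
its pullback (`CircleExtension.exists_stable`).

It remains to see that G̃_α is a Lie group. It has a finite-dimensional irreducible V with scalar
circle action. The matrix coefficients of V have weight one, and their phases trivialize the circle
bundle G̃_α → G locally. Transition functions are phases of products of a coefficient with a
conjugate coefficient. Such products are coefficients of the conjugation action on End V, on which
the circle is trivial, so they come from a continuous homomorphism on G, smooth by the convolution
argument of `contMDiff_of_continuous_monoidHom`. In this structure multiplication and inversion are
smooth because they are polynomial, respectively conjugate linear, in the coefficients. -/

noncomputable section

namespace ProjUnitary

/-! ### Finite-dimensional and irreducible subrepresentations of a compact group -/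

section CompactGroupReps

open MeasureTheory

variable {E : Type w} [Group E] {H : Type v} [NormedAddCommGroup H] [InnerProductSpace ℂ H]

theorem UH.mul_apply (S T : UH H) (x : H) : (S * T) x = S (T x) := rfl

theorem UH.inv_apply_self (S : UH H) (x : H) : S⁻¹ (S x) = x := S.symm_apply_apply x

theorem UH.apply_inv_self (S : UH H) (x : H) : S (S⁻¹ x) = x := S.apply_symm_apply x

theorem UH.inner_apply_left (S : UH H) (x y : H) : inner ℂ (S x) y = inner ℂ x (S⁻¹ y) := by
  rw [← S.inner_map_map x (S⁻¹ y), UH.apply_inv_self]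

variable [TopologicalSpace E]

theorem continuous_apply_hom (α : E →ₜ* UH H) (x : H) : Continuous fun g => α g x :=
  continuous_UH_iff.1 α.continuous_toFun x

/-- A closed convex set contains the averages of its points. This is applied both to the compact
operators and to a closed invariant subspace. -/
theorem integral_mem_of_isClosed {X F : Type*} [MeasurableSpace X] {μ : Measure X}
    [IsProbabilityMeasure μ] [NormedAddCommGroup F] [NormedSpace ℂ F] [CompleteSpace F]
    (S : Submodule ℂ F) (hS : IsClosed (S : Set F)) {f : X → F} (hf : Integrable f μ)
    (h : ∀ x, f x ∈ S) : ∫ x, f x ∂μ ∈ S :=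
  (S.restrictScalars ℝ).convex.integral_mem hS (Filter.Eventually.of_forall h) hf

/-- The orthogonal projection to the line of `u`, up to normalization. -/
def lineOp (u : H) : H →L[ℂ] H := (innerSL ℂ u).smulRight u

@[simp] theorem lineOp_apply (u x : H) : lineOp u x = inner ℂ u x • u := by
  simp [lineOp]

/-- Continuity is for the operator norm. Composed with a strongly continuous orbit map it gives a
norm-continuous family of operators, which can be averaged by a Bochner integral. -/
theorem continuous_lineOp : Continuous (lineOp : H → H →L[ℂ] H) := by
  have : (lineOp : H → H →L[ℂ] H) = fun u =>
      ContinuousLinearMap.smulRightL ℂ H H (innerSL ℂ u) u := by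
    funext u; rfl
  rw [this]
  fun_prop

theorem isCompactOperator_lineOp (u : H) : IsCompactOperator (lineOp u) := by
  have h : IsCompactOperator ((ContinuousLinearMap.id ℂ ℂ).smulRight u) :=
    isCompactOperator_of_locallyCompactSpace_rng ((ContinuousLinearMap.id ℂ ℂ).smulRight u)
  exact h.comp_clm (innerSL ℂ u)

theorem exists_probability_haar [IsTopologicalGroup E] [CompactSpace E] [MeasurableSpace E]
    [BorelSpace E] : ∃ μ : Measure E, μ.IsHaarMeasure ∧ IsProbabilityMeasure μ ∧ μ.Regular :=
  ⟨Measure.haarMeasure ⊤, inferInstance, ⟨by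
    simpa using Measure.haarMeasure_self (K₀ := (⊤ : TopologicalSpace.PositiveCompacts E))⟩,
    inferInstance⟩

/-- A closed nonzero invariant subspace contains a finite-dimensional one. -/
theorem exists_finiteDimensional_invariant [IsTopologicalGroup E] [CompactSpace E]
    [CompleteSpace H] (α : E →ₜ* UH H) (K : Submodule ℂ H) (hK : IsClosed (K : Set H))
    (hinv : ∀ g, ∀ x ∈ K, α g x ∈ K) (hne : K ≠ ⊥) :
    ∃ W : Submodule ℂ H, W ≤ K ∧ W ≠ ⊥ ∧ FiniteDimensional ℂ W ∧ ∀ g, ∀ x ∈ W, α g x ∈ W := by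
  borelize E
  obtain ⟨μ, hμ, hμ', -⟩ := exists_probability_haar (E := E)
  obtain ⟨v, hvK, hv⟩ := K.exists_mem_ne_zero_of_ne_bot hne
  have hcont : Continuous fun g => lineOp (α g v) :=
    continuous_lineOp.comp (continuous_apply_hom α v)
  have hint : Integrable (fun g => lineOp (α g v)) μ :=
    hcont.integrable_of_hasCompactSupport (HasCompactSupport.of_compactSpace _)
  -- Averaging the rank-one operators along the orbit of `v` gives a compact symmetric operator that
  -- commutes with the group and maps into `K`.
  set T : H →L[ℂ] H := ∫ g, lineOp (α g v) ∂μ with hT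
  have hTx : ∀ x, T x = ∫ g, inner ℂ (α g v) x • α g v ∂μ := fun x => by
    rw [hT, ContinuousLinearMap.integral_apply hint]
    simp
  have hintx : ∀ x, Integrable (fun g => inner ℂ (α g v) x • α g v) μ := fun x => by
    simpa using hint.apply_continuousLinearMap x
  have hTcomp : IsCompactOperator T :=
    integral_mem_of_isClosed (compactOperator (RingHom.id ℂ) H H)
      isClosed_setOfPred_isCompactOperator hint fun g => isCompactOperator_lineOp _
  have hTK : ∀ x, T x ∈ K := fun x => by
    rw [hTx]
    exact integral_mem_of_isClosed K hK (hintx x) fun g => K.smul_mem _ (hinv g v hvK)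
  have hTinner : ∀ x y, inner ℂ x (T y) = ∫ g, inner ℂ (α g v) y * inner ℂ x (α g v) ∂μ := by
    intro x y
    rw [hTx, ← integral_inner (hintx y)]
    simp [inner_smul_right]
  have hTsymm : T.IsSymmetric := by
    intro x y
    change inner ℂ (T x) y = inner ℂ x (T y)
    rw [← inner_conj_symm, hTinner, hTinner, ← integral_conj]
    congr 1
    funext g
    simp [mul_comm]
  have hTcomm : ∀ h x, T (α h x) = α h (T x) := by
    intro h x
    have h1 : α h (T x) = ∫ g, inner ℂ (α g v) x • α (h * g) v ∂μ := by
      rw [hTx]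
      change (α h).toContinuousLinearEquiv.toContinuousLinearMap _ = _
      rw [← ContinuousLinearMap.integral_comp_comm _ (hintx x)]
      simp [UH.mul_apply]
    rw [h1, hTx, ← integral_mul_left_eq_self _ h]
    congr 1
    funext g
    rw [map_mul, UH.mul_apply, LinearIsometryEquiv.inner_map_map]
  -- The number ⟨v, Tv⟩ is the integral of |⟨v, gv⟩|², a continuous nonnegative function that is
  -- positive at g = 1.
  have hT0 : T ≠ 0 := by
    intro h0
    have h1 : inner ℂ v (T v) = 0 := by simp [h0]
    rw [hTinner] at h1
    have h2 : ∀ g, inner ℂ (α g v) v * inner ℂ v (α g v) =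
        ((‖(inner ℂ v (α g v) : ℂ)‖ ^ 2 : ℝ) : ℂ) := fun g => by
      rw [← inner_conj_symm, mul_comm, Complex.mul_conj, Complex.normSq_eq_norm_sq]
    simp only [h2] at h1
    rw [integral_complex_ofReal, Complex.ofReal_eq_zero] at h1
    have hc : Continuous fun g => ‖(inner ℂ v (α g v) : ℂ)‖ ^ 2 :=
      ((continuous_const.inner (continuous_apply_hom α v)).norm).pow 2
    have h3 := (hc.integral_pos_of_hasCompactSupport_nonneg_nonzero (μ := μ) (x := 1)
      (HasCompactSupport.of_compactSpace _) (fun g => by positivity) (by simpa using hv)).ne'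
    exact h3 h1
  -- By the spectral theorem a nonzero compact symmetric operator has a nonzero eigenvalue. Its
  -- eigenspace is finite dimensional, invariant, and contained in the range of `T`, hence in `K`.
  have hex : ∃ c, Module.End.HasEigenvalue (T : Module.End ℂ H) c ∧ c ≠ 0 := by
    by_contra! hcon
    exact hT0 ((ContinuousLinearMap.eq_zero_of_forall_hasEigenvalue_eq_zero hTcomp hTsymm).1 hcon)
  obtain ⟨c, hc, hc0⟩ := hex
  refine ⟨Module.End.eigenspace (T : Module.End ℂ H) c, ?_, hc,
    ContinuousLinearMap.finite_dimensional_eigenspace hTcomp c hc0, ?_⟩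
  · intro x hx
    have h1 : T x = c • x := Module.End.mem_eigenspace_iff.1 hx
    have h2 : x = c⁻¹ • T x := by rw [h1, smul_smul, inv_mul_cancel₀ hc0, one_smul]
    rw [h2]
    exact K.smul_mem _ (hTK x)
  · intro g x hx
    have h1 : T x = c • x := Module.End.mem_eigenspace_iff.1 hx
    refine Module.End.mem_eigenspace_iff.2 ?_
    change T (α g x) = c • α g x
    rw [hTcomm, h1, map_smul]

/-- A unitary representation restricts to an invariant subspace, given as the range of a linear
isometry. -/
theorem exists_hom_of_linearIsometry {L : Type*} [NormedAddCommGroup L] [InnerProductSpace ℂ L]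
    (α : E →ₜ* UH L) (f : H →ₗᵢ[ℂ] L) (hf : ∀ g x, ∃ y, f y = α g (f x)) :
    ∃ ρ : E →ₜ* UH H, ∀ g x, f (ρ g x) = α g (f x) := by
  -- Since `f` is injective, these preimages are unique, so every identity for `A` can be checked
  -- after applying `f`.
  choose A hA using hf
  let ρ (g : E) : UH H :=
    { toFun := A g
      invFun := A g⁻¹
      map_add' := fun x y => f.injective (by simp [hA])
      map_smul' := fun c x => f.injective (by simp [hA])
      left_inv := fun x => f.injective (by rw [hA, hA, map_inv, UH.inv_apply_self])
      right_inv := fun x => f.injective (by rw [hA, hA, map_inv, UH.apply_inv_self])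
      norm_map' := fun x => by
        change ‖A g x‖ = ‖x‖
        rw [← f.norm_map, hA, (α g).norm_map, f.norm_map] }
  have hρ : ∀ g x, f (ρ g x) = α g (f x) := hA
  exact ⟨
    { toFun := ρ
      map_one' := LinearIsometryEquiv.ext fun x => f.injective (by rw [hρ, map_one]; rfl)
      map_mul' := fun g h => LinearIsometryEquiv.ext fun x => f.injective (by
        rw [hρ, map_mul, UH.mul_apply, UH.mul_apply, hρ, hρ])
      continuous_toFun := by
        rw [continuous_UH_iff]
        intro x
        rw [f.isometry.isEmbedding.continuous_iff]
        exact (continuous_apply_hom α (f x)).congr fun g => (hρ g x).symm }, hρ⟩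

/-- Equivariant linear isometries from an irreducible representation to `H`. -/
abbrev EquivIsom (V : Irrep E) (α : E →ₜ* UH H) : Type _ :=
  {f : EuclideanSpace ℂ (Fin V.dim) →ₗᵢ[ℂ] H // ∀ g x, f (V.hom g x) = α g (f x)}

/-- Take a nonzero invariant subspace of least dimension; an invariant subspace of it has at least
that dimension, so it is everything. -/
theorem exists_minimal_invariant (α : E →ₜ* UH H) (W : Submodule ℂ H) (hne : W ≠ ⊥)
    [FiniteDimensional ℂ W] (hinv : ∀ g, ∀ x ∈ W, α g x ∈ W) :
    ∃ W' ≤ W, W' ≠ ⊥ ∧ (∀ g, ∀ x ∈ W', α g x ∈ W') ∧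
      ∀ S ≤ W', S ≠ ⊥ → (∀ g, ∀ x ∈ S, α g x ∈ S) → S = W' := by
  let P : Set ℕ := {n | ∃ W' ≤ W, W' ≠ ⊥ ∧ (∀ g, ∀ x ∈ W', α g x ∈ W') ∧ Module.finrank ℂ W' = n}
  have hP : P.Nonempty := ⟨_, W, le_rfl, hne, hinv, rfl⟩
  obtain ⟨W', hle, hne', hinv', hrank⟩ := Nat.sInf_mem hP
  refine ⟨W', hle, hne', hinv', fun S hS hS0 hSinv => ?_⟩
  have : FiniteDimensional ℂ W' := Submodule.finiteDimensional_of_le hle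
  refine Submodule.eq_of_le_of_finrank_le hS ?_
  rw [hrank]
  exact Nat.sInf_le ⟨S, hS.trans hle, hS0, hSinv, rfl⟩

/-- A finite-dimensional nonzero invariant subspace contains an irreducible one. -/
theorem exists_irrep_of_invariant (α : E →ₜ* UH H) (W : Submodule ℂ H) (hne : W ≠ ⊥)
    [FiniteDimensional ℂ W] (hinv : ∀ g, ∀ x ∈ W, α g x ∈ W) :
    ∃ (V : Irrep E) (f : EquivIsom V α), ∀ x, f.1 x ∈ W := by
  obtain ⟨W', hle, hne', hinv', hmin⟩ := exists_minimal_invariant α W hne hinv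
  have : FiniteDimensional ℂ W' := Submodule.finiteDimensional_of_le hle
  let b := stdOrthonormalBasis ℂ W'
  let d := Module.finrank ℂ W'
  let f : EuclideanSpace ℂ (Fin d) →ₗᵢ[ℂ] H := W'.subtypeₗᵢ.comp b.repr.symm.toLinearIsometry
  have hfW : ∀ x, f x ∈ W' := fun x => (b.repr.symm x).2
  have hf : ∀ (x : H) (hx : x ∈ W'), f (b.repr ⟨x, hx⟩) = x := fun x hx => by simp [f]
  obtain ⟨hom, hhom⟩ := exists_hom_of_linearIsometry α f fun g x =>
    ⟨_, hf _ (hinv' g _ (hfW x))⟩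
  have hirr : (toRep hom.toMonoidHom).IsIrreducible := by
    have hd : 0 < d := by
      have : Nontrivial W' := (Submodule.nontrivial_iff_ne_bot).2 hne'
      exact Module.finrank_pos
    have hnt : Nontrivial (EuclideanSpace ℂ (Fin d)) := by
      have : Nonempty (Fin d) := ⟨⟨0, hd⟩⟩
      infer_instance
    refine { exists_pair_ne := ⟨⊥, ⊤, fun h => ?_⟩, eq_bot_or_eq_top := fun S => ?_ }
    · obtain ⟨x, hx⟩ := exists_ne (0 : EuclideanSpace ℂ (Fin d))
      have h1 : x ∈ (⊤ : Subrepresentation (toRep hom.toMonoidHom)).toSubmodule :=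
        Submodule.mem_top
      rw [← h] at h1
      exact hx ((Submodule.mem_bot ℂ).1 h1)
    · by_cases h0 : S.toSubmodule = ⊥
      · exact Or.inl (Subrepresentation.toSubmodule_injective h0)
      · right
        refine Subrepresentation.toSubmodule_injective (eq_top_iff.2 fun x _ => ?_)
        -- A nonzero subrepresentation of the coordinate model maps to a nonzero invariant subspace
        -- of `W'`, which minimality forces to be all of `W'`.
        have h1 : S.toSubmodule.map f.toLinearMap = W' := by
          refine hmin _ ?_ ?_ ?_
          · rintro _ ⟨y, -, rfl⟩
            exact hfW y
          · intro h1
            exact h0 (Submodule.map_injective_of_injective f.injective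
              (h1.trans (Submodule.map_bot _).symm))
          · rintro g _ ⟨y, hy, rfl⟩
            exact ⟨hom g y, S.apply_mem_toSubmodule g hy, hhom g y⟩
        have h2 : f x ∈ S.toSubmodule.map f.toLinearMap := by
          rw [h1]
          exact hfW x
        obtain ⟨y, hy, hyx⟩ := h2
        rwa [← f.injective hyx]
  exact ⟨⟨d, hom, hirr⟩, ⟨f, hhom⟩, fun x => hle (hfW x)⟩

end CompactGroupReps

/-! ### Schur's lemma and decomposition into irreducibles -/

section Decomposition

variable {E : Type w} [Group E] [TopologicalSpace E]
  {H : Type v} [NormedAddCommGroup H] [InnerProductSpace ℂ H]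

/-- Isomorphism of irreducible representations. -/
instance irrepSetoid (E : Type w) [Group E] [TopologicalSpace E] : Setoid (Irrep E) where
  r V W := Nonempty ((toRep V.hom.toMonoidHom).Equiv (toRep W.hom.toMonoidHom))
  iseqv := ⟨fun _ => ⟨.refl _⟩, fun ⟨e⟩ => ⟨e.symm⟩, fun ⟨e⟩ ⟨f⟩ => ⟨e.trans f⟩⟩

/-- By Schur's lemma T*T is a scalar c, which is positive because T ≠ 0. So ‖Tx‖ = √c ‖x‖, and
dividing by √c makes T isometric. -/
theorem Irrep.exists_smul_equivIsom [CompleteSpace H] (V : Irrep E) (α : E →ₜ* UH H)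
    (T : Representation.IntertwiningMap (toRep V.hom.toMonoidHom) (toRep α.toMonoidHom))
    (hT : T ≠ 0) : ∃ (f : EquivIsom V α) (c : ℂ), c ≠ 0 ∧ ∀ x, f.1 x = c • T x := by
  have hirr := V.irreducible
  have hTe : ∀ g x, T (V.hom g x) = α g (T x) := fun g x =>
    Representation.IntertwiningMap.isIntertwining _ _ T g x
  let L : EuclideanSpace ℂ (Fin V.dim) →L[ℂ] H := LinearMap.toContinuousLinearMap T.toLinearMap
  have hL : ∀ x, L x = T x := fun x => rfl
  let A : EuclideanSpace ℂ (Fin V.dim) →L[ℂ] EuclideanSpace ℂ (Fin V.dim) := L.adjoint ∘L L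
  have hAinner : ∀ x y, inner ℂ x (A y) = inner ℂ (T x) (T y) := fun x y => by
    simp [A, ContinuousLinearMap.adjoint_inner_right, hL]
  let B : Representation.IntertwiningMap (toRep V.hom.toMonoidHom) (toRep V.hom.toMonoidHom) :=
    LinearMap.intertwiningMap_of_isIntertwiningMap _ _ A.toLinearMap fun g x => by
      refine ext_inner_left ℂ fun y => ?_
      change inner ℂ y (A (V.hom g x)) = inner ℂ y (V.hom g (A x))
      rw [hAinner, hTe, ← inner_conj_symm y, UH.inner_apply_left, inner_conj_symm, ← map_inv,
        hAinner, hTe, map_inv, ← inner_conj_symm (T y), UH.inner_apply_left, inner_conj_symm]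
  obtain ⟨c, hc⟩ :=
    (Representation.IsIrreducible.algebraMap_intertwiningMap_bijective_of_isAlgClosed
      (ρ := toRep V.hom.toMonoidHom)).2 B
  have hAc : ∀ x, A x = c • x := fun x => by
    have h1 : B x = A x := rfl
    rw [← h1, ← hc]
    rfl
  have hnorm : ∀ x, ‖T x‖ ^ 2 = c.re * ‖x‖ ^ 2 := fun x => by
    have h1 := hAinner x x
    rw [hAc, inner_smul_right, inner_self_eq_norm_sq_to_K, inner_self_eq_norm_sq_to_K] at h1
    have h2 : (c * ((‖x‖ ^ 2 : ℝ) : ℂ)).re = ((‖T x‖ ^ 2 : ℝ) : ℂ).re := by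
      push_cast
      exact congrArg Complex.re h1
    rw [Complex.re_mul_ofReal, Complex.ofReal_re] at h2
    exact h2.symm
  obtain ⟨x, hx⟩ : ∃ x, T x ≠ 0 := by
    by_contra! h
    exact hT (Representation.IntertwiningMap.ext (LinearMap.ext h))
  have hc0 : 0 < c.re := by
    by_contra! h
    have h1 : 0 < ‖T x‖ ^ 2 := by positivity
    rw [hnorm] at h1
    nlinarith [sq_nonneg ‖x‖]
  let s : ℝ := Real.sqrt c.re
  have hs : 0 < s := Real.sqrt_pos.2 hc0
  have hTn : ∀ x, ‖T x‖ = s * ‖x‖ := fun x => by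
    rw [← Real.sqrt_sq (norm_nonneg (T x)), hnorm, Real.sqrt_mul hc0.le,
      Real.sqrt_sq (norm_nonneg x)]
  refine ⟨⟨⟨((s : ℂ)⁻¹) • T.toLinearMap, fun x => ?_⟩, fun g x => ?_⟩, (s : ℂ)⁻¹, ?_, fun x => rfl⟩
  · change ‖((s : ℂ)⁻¹) • T x‖ = ‖x‖
    rw [norm_smul, hTn, norm_inv, Complex.norm_real, Real.norm_of_nonneg hs.le]
    field_simp
  · change ((s : ℂ)⁻¹) • T (V.hom g x) = α g (((s : ℂ)⁻¹) • T x)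
    rw [hTe, map_smul]
  · exact inv_ne_zero (Complex.ofReal_ne_zero.2 hs.ne')

/-- An equivariant isometry as an intertwining map. -/
def EquivIsom.toIntertwining {V : Irrep E} {α : E →ₜ* UH H} (f : EquivIsom V α) :
    Representation.IntertwiningMap (toRep V.hom.toMonoidHom) (toRep α.toMonoidHom) :=
  LinearMap.intertwiningMap_of_isIntertwiningMap _ _ f.1.toLinearMap f.2

theorem Irrep.exists_ne_zero (V : Irrep E) : ∃ x : EuclideanSpace ℂ (Fin V.dim), x ≠ 0 := by
  by_contra! h
  have := V.irreducible
  obtain ⟨S, S', hS⟩ := exists_pair_ne (Subrepresentation (toRep V.hom.toMonoidHom))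
  refine hS (Subrepresentation.toSubmodule_injective (Submodule.ext fun x => ?_))
  rw [h x]
  simp

/-- Non-orthogonal irreducible summands are isomorphic. -/
theorem EquivIsom.equiv_of_inner_ne_zero [CompleteSpace H] {V W : Irrep E} {α : E →ₜ* UH H}
    (f : EquivIsom V α)
    (T : Representation.IntertwiningMap (toRep W.hom.toMonoidHom) (toRep α.toMonoidHom))
    {x y} (hxy : inner ℂ (f.1 x) (T y) ≠ 0) : W ≈ V := by
  have hirr := V.irreducible
  have hirr' := W.irreducible
  have hTe : ∀ g x, T (W.hom g x) = α g (T x) := fun g x =>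
    Representation.IntertwiningMap.isIntertwining _ _ T g x
  let L : EuclideanSpace ℂ (Fin W.dim) →L[ℂ] H := LinearMap.toContinuousLinearMap T.toLinearMap
  -- The compression f*T intertwines the two irreducibles and has ⟨f x, T y⟩ as a matrix entry. It
  -- is therefore nonzero, hence bijective by Schur's lemma.
  let A : EuclideanSpace ℂ (Fin W.dim) →L[ℂ] EuclideanSpace ℂ (Fin V.dim) :=
    f.1.toContinuousLinearMap.adjoint ∘L L
  have hA : ∀ x y, inner ℂ x (A y) = inner ℂ (f.1 x) (T y) := fun x y => by
    simp only [A, ContinuousLinearMap.comp_apply, ContinuousLinearMap.adjoint_inner_right]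
    rfl
  let B : Representation.IntertwiningMap (toRep W.hom.toMonoidHom) (toRep V.hom.toMonoidHom) :=
    LinearMap.intertwiningMap_of_isIntertwiningMap _ _ A.toLinearMap fun g x => by
      refine ext_inner_left ℂ fun y => ?_
      change inner ℂ y (A (W.hom g x)) = inner ℂ y (V.hom g (A x))
      rw [hA, hTe, ← inner_conj_symm y, UH.inner_apply_left, inner_conj_symm, ← map_inv,
        hA, f.2, map_inv, ← inner_conj_symm (f.1 y), UH.inner_apply_left, inner_conj_symm]
  have hB : B ≠ 0 := fun h => by
    have h1 : A y = 0 := congrArg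
      (fun C : Representation.IntertwiningMap (toRep W.hom.toMonoidHom)
        (toRep V.hom.toMonoidHom) => C y) h
    have h2 := hA x y
    rw [h1, inner_zero_right] at h2
    exact hxy h2.symm
  exact ⟨Representation.IntertwiningMap.ofBijective B
    ((Representation.IsIrreducible.bijective_or_eq_zero B).resolve_right hB)⟩

/-- The equivariant isometric embeddings into `H` of chosen representatives of the isomorphism
classes of irreducible representations. -/
abbrev Summand (α : E →ₜ* UH H) : Type _ := Σ q : Quotient (irrepSetoid E), EquivIsom q.out α

/-- Orthogonality of summands. -/
def Summand.Orth {α : E →ₜ* UH H} (i j : Summand α) : Prop :=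
  ∀ x y, inner ℂ (i.2.1 x) (j.2.1 y) = 0

theorem Summand.Orth.symm {α : E →ₜ* UH H} {i j : Summand α} (h : i.Orth j) : j.Orth i :=
  fun x y => by rw [← inner_conj_symm, h, map_zero]

/-- A unitary representation of a compact group is a Hilbert sum of irreducible ones. -/
theorem exists_decomposition [IsTopologicalGroup E] [CompactSpace E] [CompleteSpace H]
    (α : E →ₜ* UH H) : ∃ s : Set (Summand α), s.Pairwise Summand.Orth ∧
      (⨆ i : s, LinearMap.range i.1.2.1.toLinearMap).topologicalClosure = ⊤ := by
  obtain ⟨s, hs⟩ := zorn_subset {s : Set (Summand α) | s.Pairwise Summand.Orth} (by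
    intro c hc hchain
    refine ⟨⋃₀ c, ?_, fun s hs => Set.subset_sUnion_of_mem hs⟩
    exact (Set.pairwise_sUnion hchain.directedOn).2 fun s hs => hc hs)
  refine ⟨s, hs.prop, ?_⟩
  set S : Submodule ℂ H := ⨆ i : s, LinearMap.range i.1.2.1.toLinearMap with hS
  by_contra hne
  have hmem : ∀ i ∈ s, ∀ x, i.2.1 x ∈ S := fun i hi x =>
    Submodule.mem_iSup_of_mem (⟨i, hi⟩ : s) ⟨x, rfl⟩
  have hperp : ∀ y, y ∈ Sᗮ ↔ ∀ i ∈ s, ∀ x, inner ℂ (i.2.1 x) y = 0 := by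
    intro y
    constructor
    · intro hy i hi x
      exact (Submodule.mem_orthogonal S y).1 hy _ (hmem i hi x)
    · intro h
      rw [hS, ← Submodule.iInf_orthogonal, Submodule.mem_iInf]
      rintro ⟨i, hi⟩
      rw [Submodule.mem_orthogonal]
      rintro _ ⟨x, rfl⟩
      exact h i hi x
  have hbot : Sᗮ ≠ ⊥ := fun h => hne (by
    rwa [Submodule.topologicalClosure_eq_top_iff])
  -- If the summands did not span densely, their orthogonal complement, closed and invariant, would
  -- contain an irreducible summand.
  obtain ⟨W, hWS, hW0, hWf, hWinv⟩ := exists_finiteDimensional_invariant α Sᗮ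
    (Submodule.isClosed_orthogonal S) (by
      intro g y hy
      rw [hperp] at hy ⊢
      intro i hi x
      have h1 : i.2.1 x = α g (i.2.1 (i.1.out.hom g⁻¹ x)) := by
        rw [i.2.2, map_inv, UH.apply_inv_self]
      rw [h1, LinearIsometryEquiv.inner_map_map]
      exact hy i hi _) hbot
  obtain ⟨V, f, hf⟩ := exists_irrep_of_invariant α W hW0 hWinv
  -- The irreducible found is replaced by the chosen representative of its class. The composite
  -- embedding is rescaled to an isometry, which keeps its image inside `W`.
  let q : Quotient (irrepSetoid E) := Quotient.mk _ V
  obtain ⟨e⟩ : q.out ≈ V := Quotient.mk_out V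
  let T := f.toIntertwining.comp e.toIntertwiningMap
  have hTx : ∀ x, T x = f.1 (e x) := fun x => rfl
  have hT : T ≠ 0 := by
    intro h
    obtain ⟨x, hx⟩ := q.out.exists_ne_zero
    have h1 : T x = 0 := by rw [h]; rfl
    rw [hTx] at h1
    have h2 : e x = 0 := f.1.injective (h1.trans (map_zero f.1).symm)
    exact hx (e.toLinearEquiv.injective (h2.trans (map_zero e.toLinearEquiv).symm))
  obtain ⟨f', c, hc, hf'⟩ := q.out.exists_smul_equivIsom α T hT
  let j : Summand α := ⟨q, f'⟩
  have hjW : ∀ x, j.2.1 x ∈ W := fun x => by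
    change f'.1 x ∈ W
    rw [hf', hTx]
    exact W.smul_mem _ (hf _)
  have hj : ∀ i ∈ s, i.Orth j := fun i hi x y => (hperp _).1 (hWS (hjW y)) i hi x
  have hins : (insert j s).Pairwise Summand.Orth :=
    (hs.prop).insert fun i hi _ => ⟨(hj i hi).symm, hj i hi⟩
  -- Maximality puts `j` into `s`; being orthogonal to every member of `s`, it is then orthogonal to
  -- itself.
  have hjs : j ∈ s := hs.le_of_ge hins (Set.subset_insert j s) (Set.mem_insert j s)
  obtain ⟨x, hx⟩ := q.out.exists_ne_zero
  have h1 := hj j hjs x x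
  rw [inner_self_eq_zero] at h1
  exact hx (j.2.1.injective (h1.trans (map_zero j.2.1).symm))

end Decomposition

/-! ### Multiplicities and uniqueness of stable representations -/

section StableDecomposition

variable {E : Type w} [Group E] [TopologicalSpace E]
  {H : Type v} [NormedAddCommGroup H] [InnerProductSpace ℂ H]

theorem EquivIsom.range_le_isotypic {V : Irrep E} {α : E →ₜ* UH H} (f : EquivIsom V α) :
    LinearMap.range f.1.toLinearMap ≤ isotypic α V :=
  le_iSup (fun T : Representation.IntertwiningMap (toRep V.hom.toMonoidHom)
    (toRep α.toMonoidHom) => LinearMap.range T.toLinearMap) f.toIntertwining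

/-- The summands of a given class span the isotypical component. -/
theorem isotypic_le_of_finite [CompleteSpace H] {α : E →ₜ* UH H} {s : Set (Summand α)}
    (hs : s.Pairwise Summand.Orth)
    (hd : (⨆ i : s, LinearMap.range i.1.2.1.toLinearMap).topologicalClosure = ⊤)
    (q : Quotient (irrepSetoid E)) (hfin : {φ : EquivIsom q.out α | ⟨q, φ⟩ ∈ s}.Finite) :
    FiniteDimensional ℂ (isotypic α q.out) := by
  let F : Set (EquivIsom q.out α) := {φ | ⟨q, φ⟩ ∈ s}
  have : Finite F := hfin
  let P : Submodule ℂ H := ⨆ φ : F, LinearMap.range φ.1.1.toLinearMap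
  have hP : FiniteDimensional ℂ P := Submodule.finiteDimensional_iSup _
  have : P.HasOrthogonalProjection := inferInstance
  suffices h : isotypic α q.out ≤ P from Submodule.finiteDimensional_of_le h
  refine iSup_le fun T => ?_
  rintro _ ⟨v, rfl⟩
  change T v ∈ P
  rw [← Submodule.orthogonal_orthogonal P, Submodule.mem_orthogonal]
  intro y hy
  have hTe : ∀ g x, T (q.out.hom g x) = α g (T x) := fun g x =>
    Representation.IntertwiningMap.isIntertwining _ _ T g x
  -- The component of `T v` off `P` is orthogonal to every summand: to those of class `q` because
  -- they lie in `P`, to the others by Schur's lemma. By density it vanishes.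
  set z := T v - P.starProjection (T v) with hz
  have hzP : z ∈ Pᗮ := Submodule.sub_starProjection_mem_orthogonal _
  have hPorth : ∀ i ∈ s, i.1 ≠ q → ∀ x, ∀ p ∈ P, inner ℂ (i.2.1 x) p = 0 := by
    intro i hi hiq x p hp
    have h1 : P ≤ (Submodule.span ℂ {i.2.1 x})ᗮ := by
      refine iSup_le fun φ => ?_
      rintro _ ⟨w, rfl⟩
      rw [Submodule.mem_orthogonal_singleton_iff_inner_right]
      exact hs hi φ.2 (fun h => hiq (congrArg Sigma.fst h)) x w
    exact Submodule.mem_orthogonal_singleton_iff_inner_right.1 (h1 hp)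
  have hz0 : z = 0 := by
    have h1 : (⨆ i : s, LinearMap.range i.1.2.1.toLinearMap)ᗮ = ⊥ := by
      rwa [← Submodule.topologicalClosure_eq_top_iff]
    rw [← Submodule.mem_bot ℂ, ← h1, ← Submodule.iInf_orthogonal, Submodule.mem_iInf]
    rintro ⟨⟨q', φ⟩, hi⟩
    rw [Submodule.mem_orthogonal]
    rintro _ ⟨x, rfl⟩
    change inner ℂ (φ.1 x) z = 0
    by_cases hq : q' = q
    · subst hq
      exact (Submodule.mem_orthogonal _ _).1 hzP _
        (Submodule.mem_iSup_of_mem (⟨φ, hi⟩ : F) ⟨x, rfl⟩)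
    · rw [hz, inner_sub_right, hPorth _ hi hq x _ (Submodule.starProjection_apply_mem _ _),
        sub_zero]
      by_contra hne
      exact hq (Quotient.out_equiv_out.1 (φ.equiv_of_inner_ne_zero T hne)).symm
  have hTP : T v ∈ P := by
    rw [hz, sub_eq_zero] at hz0
    rw [hz0]
    exact Submodule.starProjection_apply_mem _ _
  rw [← inner_conj_symm, (Submodule.mem_orthogonal _ _).1 hy _ hTP, map_zero]

/-- Distinct members are at distance √2, so the balls of radius 1/2 around them are disjoint open
sets in a separable space. -/
theorem countable_of_orthonormal [TopologicalSpace.SeparableSpace H] {ι : Type*} {u : ι → H}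
    (hu : Orthonormal ℂ u) : Countable ι := by
  have h1 : (Set.univ : Set ι).PairwiseDisjoint fun i => Metric.ball (u i) (1 / 2) := by
    intro i _ j _ hij
    refine Metric.ball_disjoint_ball ?_
    have h2 : ‖u i - u j‖ ^ 2 = 2 := by
      rw [@norm_sub_sq ℂ, hu.2 hij, hu.1 i, hu.1 j]
      norm_num
    rw [dist_eq_norm]
    nlinarith [norm_nonneg (u i - u j)]
  have h2 := h1.countable_of_isOpen (fun i _ => Metric.isOpen_ball)
    (fun i _ => ⟨u i, Metric.mem_ball_self (by norm_num)⟩)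
  exact Set.countable_univ_iff.1 h2

theorem countable_of_orthogonal [TopologicalSpace.SeparableSpace H] {α : E →ₜ* UH H}
    {s : Set (Summand α)} (hs : s.Pairwise Summand.Orth) : s.Countable := by
  have hu : ∀ i : s, ∃ x, ‖i.1.2.1 x‖ = 1 := fun i => by
    obtain ⟨x, hx⟩ := i.1.1.out.exists_ne_zero
    refine ⟨((‖x‖⁻¹ : ℝ) : ℂ) • x, ?_⟩
    rw [LinearIsometry.norm_map, norm_smul, Complex.norm_real, norm_inv, norm_norm,
      inv_mul_cancel₀ (norm_ne_zero_iff.2 hx)]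
  choose x hx using hu
  have horth : Orthonormal ℂ fun i : s => i.1.2.1 (x i) :=
    ⟨hx, fun i j hij => hs i.2 j.2 (fun h => hij (Subtype.ext h)) _ _⟩
  exact countable_of_orthonormal horth

/-- For a stable representation, the multiplicity of each representation in the given set is
countably infinite. -/
theorem IsStableOn.exists_isHilbertSum [IsTopologicalGroup E] [CompactSpace E] [CompleteSpace H]
    [TopologicalSpace.SeparableSpace H] {α : E →ₜ* UH H} {C : Set (Irrep E)}
    (hα : IsStableOn α C) :
    ∃ f : ∀ j : {q : Quotient (irrepSetoid E) // q.out ∈ C} × ℕ, EquivIsom j.1.1.out α,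
      IsHilbertSum ℂ (fun j : {q : Quotient (irrepSetoid E) // q.out ∈ C} × ℕ =>
        EuclideanSpace ℂ (Fin j.1.1.out.dim)) fun j => (f j).1 := by
  obtain ⟨s, hs, hd⟩ := exists_decomposition α
  -- Each multiplicity is infinite by stability and countable by separability. Enumerating by ℕ
  -- makes the index set depend on `C` alone, so that two stable representations can be matched
  -- summand by summand.
  have hinf : ∀ q : {q : Quotient (irrepSetoid E) // q.out ∈ C},
      Nonempty (ℕ ≃ {φ : EquivIsom q.1.out α | ⟨q.1, φ⟩ ∈ s}) := by
    rintro ⟨q, hq⟩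
    have h1 : Infinite {φ : EquivIsom q.out α | ⟨q, φ⟩ ∈ s} := by
      rw [Set.infinite_coe_iff]
      exact fun hfin => hα.1 _ hq (isotypic_le_of_finite hs hd q hfin)
    have h2 : Countable {φ : EquivIsom q.out α | ⟨q, φ⟩ ∈ s} :=
      ((countable_of_orthogonal hs).preimage sigma_mk_injective).to_subtype
    exact nonempty_equiv_of_countable
  let e := fun q => (hinf q).some
  refine ⟨fun j => (e j.1 j.2).1, IsHilbertSum.mk ?_ ?_⟩
  · intro j k hjk x y
    refine hs (e j.1 j.2).2 (e k.1 k.2).2 (fun h => hjk ?_) x y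
    obtain ⟨⟨q, hq⟩, m⟩ := j
    obtain ⟨⟨q', hq'⟩, m'⟩ := k
    obtain rfl : q = q' := congrArg Sigma.fst h
    have h1 := sigma_mk_injective h
    have h2 := (e ⟨q, hq⟩).injective (Subtype.ext h1)
    exact Prod.ext rfl h2
  · rw [← hd]
    refine Submodule.topologicalClosure_mono (iSup_le ?_)
    rintro ⟨⟨q, φ⟩, hi⟩
    -- Otherwise the summand would sit in an isotypical component that stability makes zero.
    have hq : q.out ∈ C := by
      by_contra hq
      have h1 := φ.range_le_isotypic
      rw [hα.2 _ hq, le_bot_iff] at h1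
      obtain ⟨x, hx⟩ := q.out.exists_ne_zero
      have h2 : φ.1 x ∈ LinearMap.range φ.1.toLinearMap := ⟨x, rfl⟩
      rw [h1, Submodule.mem_bot] at h2
      exact hx (φ.1.injective (h2.trans (map_zero φ.1).symm))
    obtain ⟨m, hm⟩ := (e ⟨q, hq⟩).surjective ⟨φ, hi⟩
    refine le_iSup_of_le (⟨q, hq⟩, m) ?_
    change LinearMap.range φ.1.toLinearMap ≤ LinearMap.range (e ⟨q, hq⟩ m).1.1.toLinearMap
    rw [hm]

/-- Two unitary representations that are stable for the same set are unitarily equivalent. -/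
theorem IsStableOn.exists_unitary [IsTopologicalGroup E] [CompactSpace E] [CompleteSpace H]
    [TopologicalSpace.SeparableSpace H] {α β : E →ₜ* UH H} {C : Set (Irrep E)}
    (hα : IsStableOn α C) (hβ : IsStableOn β C) : ∃ F : UH H, ∀ g, F * α g = β g * F := by
  classical
  obtain ⟨f, hf⟩ := hα.exists_isHilbertSum
  obtain ⟨f', hf'⟩ := hβ.exists_isHilbertSum
  -- `F` sends the j-th summand of α to the j-th summand of β. Equivariance holds on summands and
  -- passes to all vectors through convergent sums.
  let F : UH H := hf.linearIsometryEquiv.trans hf'.linearIsometryEquiv.symm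
  have hF : ∀ j x, F ((f j).1 x) = (f' j).1 x := fun j x => by
    change hf'.linearIsometryEquiv.symm (hf.linearIsometryEquiv ((f j).1 x)) = _
    have h1 := hf.linearIsometryEquiv_symm_apply_single (i := j) x
    rw [← h1, LinearIsometryEquiv.apply_symm_apply, hf'.linearIsometryEquiv_symm_apply_single]
  refine ⟨F, fun g => LinearIsometryEquiv.ext fun y => ?_⟩
  have hy := hf.hasSum_linearIsometryEquiv_symm (hf.linearIsometryEquiv y)
  rw [LinearIsometryEquiv.symm_apply_apply] at hy
  have h1 := hy.mapL (F * α g).toContinuousLinearEquiv.toContinuousLinearMap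
  have h2 := hy.mapL (β g * F).toContinuousLinearEquiv.toContinuousLinearMap
  refine h1.unique ?_
  convert! h2 using 2 with j
  change F (α g ((f j).1 _)) = β g (F ((f j).1 _))
  rw [hF, ← (f j).2, hF, (f' j).2]

end StableDecomposition

/-! ### Stability along isomorphisms of extensions -/

section Transfer

variable {E₁ E₂ : Type w} [Group E₁] [TopologicalSpace E₁] [Group E₂] [TopologicalSpace E₂]
  {H : Type v} [NormedAddCommGroup H] [InnerProductSpace ℂ H]

/-- Pullback of an irreducible representation along an isomorphism. -/
def Irrep.comap (φ : E₁ ≃* E₂) (hφ : Continuous φ) (V : Irrep E₂) : Irrep E₁ where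
  dim := V.dim
  hom := ⟨V.hom.toMonoidHom.comp φ.toMonoidHom, V.hom.continuous_toFun.comp hφ⟩
  irreducible := by
    have h := V.irreducible
    refine { exists_pair_ne := ?_, eq_bot_or_eq_top := fun S => ?_ }
    · obtain ⟨S, S', hS⟩ := exists_pair_ne (Subrepresentation (toRep V.hom.toMonoidHom))
      refine ⟨⟨S.toSubmodule, fun g x hx => S.apply_mem_toSubmodule (φ g) hx⟩,
        ⟨S'.toSubmodule, fun g x hx => S'.apply_mem_toSubmodule (φ g) hx⟩, fun h' => hS ?_⟩
      exact Subrepresentation.toSubmodule_injective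
        (congrArg (fun R => R.toSubmodule) h')
    · let S' : Subrepresentation (toRep V.hom.toMonoidHom) :=
        ⟨S.toSubmodule, fun g x hx => by
          have h1 := S.apply_mem_toSubmodule (φ.symm g) hx
          change V.hom (φ (φ.symm g)) x ∈ _ at h1
          rwa [φ.apply_symm_apply] at h1⟩
      exact (h.eq_bot_or_eq_top S').imp
        (fun h => Subrepresentation.toSubmodule_injective
          (show S'.toSubmodule = ⊥ from congrArg Subrepresentation.toSubmodule h))
        (fun h => Subrepresentation.toSubmodule_injective
          (show S'.toSubmodule = ⊤ from congrArg Subrepresentation.toSubmodule h))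

/-- The same linear maps are equivariant on both sides, so the two suprema range over the same
images. -/
theorem isotypic_comap_symm (φ : E₁ ≃* E₂) (hφ' : Continuous φ.symm)
    (α : E₂ →ₜ* UH H) (ρ : E₁ →ₜ* UH H) (h : ∀ e, ρ e = α (φ e)) (V : Irrep E₁) :
    isotypic α (V.comap φ.symm hφ') = isotypic ρ V := by
  apply le_antisymm
  · refine iSup_le fun T => ?_
    let T' : Representation.IntertwiningMap (toRep V.hom.toMonoidHom) (toRep ρ.toMonoidHom) :=
      LinearMap.intertwiningMap_of_isIntertwiningMap _ _ T.toLinearMap fun g x => by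
        have h1 := Representation.IntertwiningMap.isIntertwining _ _ T (φ g) x
        change T (V.hom (φ.symm (φ g)) x) = α (φ g) (T x) at h1
        rw [φ.symm_apply_apply, ← h] at h1
        exact h1
    exact le_iSup (fun T : Representation.IntertwiningMap (toRep V.hom.toMonoidHom)
      (toRep ρ.toMonoidHom) => LinearMap.range T.toLinearMap) T'
  · refine iSup_le fun T => ?_
    let T' : Representation.IntertwiningMap (toRep (V.comap φ.symm hφ').hom.toMonoidHom)
        (toRep α.toMonoidHom) :=
      LinearMap.intertwiningMap_of_isIntertwiningMap _ _ T.toLinearMap fun g x => by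
        have h1 := Representation.IntertwiningMap.isIntertwining _ _ T (φ.symm g) x
        change T (V.hom (φ.symm g) x) = ρ (φ.symm g) (T x) at h1
        rw [h, φ.apply_symm_apply] at h1
        exact h1
    exact le_iSup (fun T : Representation.IntertwiningMap
      (toRep (V.comap φ.symm hφ').hom.toMonoidHom)
      (toRep α.toMonoidHom) => LinearMap.range T.toLinearMap) T'

/-- Compatibility with the inclusions of the circle is what makes transport along φ preserve the set
of irreducibles with scalar circle action. -/
theorem IsStableOn.of_iso {G : Type u} [Group G] [TopologicalSpace G]
    {X Y : CircleExtension.{u, w} G} (φ : X.ext.Equiv Y.ext)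
    (hφ' : Continuous φ.toMulEquiv.symm) {α : Y.E →ₜ* UH H} {ρ : X.E →ₜ* UH H}
    (h : ∀ e, ρ e = α (φ.toMulEquiv e)) (hα : IsStableOn α (scalarIrreps Y)) :
    IsStableOn ρ (scalarIrreps X) := by
  have hinl : ∀ z, φ.toMulEquiv.symm (Y.ext.inl z) = X.ext.inl z := fun z => by
    rw [MulEquiv.symm_apply_eq]
    exact (congrFun φ.inl_comm z).symm
  have hmem : ∀ V : Irrep X.E, V.comap φ.toMulEquiv.symm hφ' ∈ scalarIrreps Y ↔
      V ∈ scalarIrreps X := fun V => by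
    refine forall_congr' fun z => ?_
    change V.hom (φ.toMulEquiv.symm (Y.ext.inl z)) = _ ↔ _
    rw [hinl]
    rfl
  refine ⟨fun V hV => ?_, fun V hV => ?_⟩
  · rw [← isotypic_comap_symm φ.toMulEquiv hφ' α ρ h]
    exact hα.1 _ ((hmem V).2 hV)
  · rw [← isotypic_comap_symm φ.toMulEquiv hφ' α ρ h]
    exact hα.2 _ (fun h => hV ((hmem V).1 h))

end Transfer

/-! ### Compactness of the total group -/

section Compact

variable {G : Type u} [Group G] [TopologicalSpace G]

theorem CircleExtension.exists_inl_of_rightHom_eq (X : CircleExtension.{u, w} G) {e e' : X.E}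
    (h : X.ext.rightHom e = X.ext.rightHom e') : ∃ z, e = X.ext.inl z * e' := by
  have h1 : e * e'⁻¹ ∈ X.ext.rightHom.ker := by
    rw [MonoidHom.mem_ker, map_mul, map_inv, h, mul_inv_cancel]
  rw [← X.ext.range_inl_eq_ker_rightHom] at h1
  obtain ⟨z, hz⟩ := h1
  exact ⟨z, by rw [hz, inv_mul_cancel_right]⟩

theorem CircleExtension.rightHom_inl (X : CircleExtension.{u, w} G) (z : Circle) :
    X.ext.rightHom (X.ext.inl z) = 1 := by
  have : X.ext.inl z ∈ X.ext.rightHom.ker := by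
    rw [← X.ext.range_inl_eq_ker_rightHom]
    exact ⟨z, rfl⟩
  exact this

theorem CircleExtension.continuous_inl (X : CircleExtension.{u, w} G) : Continuous X.ext.inl :=
  X.isSES.isClosedEmbedding.continuous

theorem CircleExtension.continuous_rightHom (X : CircleExtension.{u, w} G) :
    Continuous X.ext.rightHom :=
  X.isSES.isOpenQuotientMap.continuous

-- The projection is proper. Its fibres are translates of the circle, and it is a closed map since
-- the saturation of a closed set C is S¹·C, the product of a compact and a closed set.
open scoped Pointwise in
instance CircleExtension.compactSpace [CompactSpace G] (X : CircleExtension.{u, w} G) :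
    CompactSpace X.E := by
  have hK : IsCompact (Set.range X.ext.inl) := isCompact_range X.continuous_inl
  have hpre : ∀ g, IsCompact (X.ext.rightHom ⁻¹' {g}) := fun g => by
    obtain ⟨e, rfl⟩ := X.ext.rightHom_surjective g
    have h1 : X.ext.rightHom ⁻¹' {X.ext.rightHom e} =
        (fun x => x * e) '' Set.range X.ext.inl := by
      ext e'
      constructor
      · intro h
        obtain ⟨z, rfl⟩ := X.exists_inl_of_rightHom_eq h
        exact ⟨_, ⟨z, rfl⟩, rfl⟩
      · rintro ⟨_, ⟨z, rfl⟩, rfl⟩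
        simp [X.rightHom_inl]
    rw [h1]
    exact hK.image (continuous_mul_const e)
  have hclosed : IsClosedMap X.ext.rightHom := fun C hC => by
    rw [← X.isSES.isOpenQuotientMap.isQuotientMap.isClosed_preimage]
    have h1 : X.ext.rightHom ⁻¹' (X.ext.rightHom '' C) = Set.range X.ext.inl * C := by
      ext e
      constructor
      · rintro ⟨c, hc, h⟩
        obtain ⟨z, rfl⟩ := X.exists_inl_of_rightHom_eq h.symm
        exact Set.mul_mem_mul ⟨z, rfl⟩ hc
      · rintro ⟨_, ⟨z, rfl⟩, c, hc, rfl⟩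
        exact ⟨c, hc, by simp [X.rightHom_inl]⟩
    rw [h1]
    exact hC.mul_left_of_isCompact hK
  have hproper : IsProperMap X.ext.rightHom :=
    isProperMap_iff_isClosedMap_and_compact_fibers.2 ⟨X.continuous_rightHom, hclosed, hpre⟩
  exact ⟨by simpa using hproper.isCompact_preimage isCompact_univ⟩

theorem CircleExtension.exists_unitary_of_isStableOn [CompactSpace G] {H : Type v}
    [NormedAddCommGroup H] [InnerProductSpace ℂ H] [CompleteSpace H]
    [TopologicalSpace.SeparableSpace H] (X : CircleExtension.{u, w} G) {α β : X.E →ₜ* UH H}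
    {C : Set (Irrep X.E)} (hα : IsStableOn α C) (hβ : IsStableOn β C) :
    ∃ F : UH H, ∀ g, F * α g = β g * F :=
  hα.exists_unitary hβ

end Compact

/-! ### Conjugacy versus isomorphism of pullback extensions -/

section Conjugacy

variable {G : Type u} [Group G] [TopologicalSpace G] [IsTopologicalGroup G] [T2Space G]
  {H : Type v} [NormedAddCommGroup H] [InnerProductSpace ℂ H] [Nontrivial H]

/-- Conjugate homomorphisms have isomorphic pullback extensions. -/
theorem pullbackExtension_iso_of_conj {α β : G →ₜ* PUH H} (F : PUH H)
    (hF : ∀ g, F * α g * F⁻¹ = β g) : (pullbackExtension α).Iso (pullbackExtension β) := by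
  obtain ⟨U, rfl⟩ := QuotientGroup.mk_surjective F
  have h1 : ∀ p ∈ pullbackGroup α, (p.1, U * p.2 * U⁻¹) ∈ pullbackGroup β := fun p hp => by
    rw [mem_pullbackGroup] at hp ⊢
    change β p.1 = _
    rw [← hF, hp]
    rfl
  have h2 : ∀ p ∈ pullbackGroup β, (p.1, U⁻¹ * p.2 * U) ∈ pullbackGroup α := fun p hp => by
    rw [mem_pullbackGroup] at hp ⊢
    change α p.1 = ((U⁻¹ : UH H) : PUH H) * (p.2 : PUH H) * (U : PUH H)
    rw [← hp, ← hF, QuotientGroup.mk_inv]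
    group
  let φ : (pullbackExtension α).E ≃* (pullbackExtension β).E :=
    { toFun := fun p => ⟨_, h1 p.1 p.2⟩
      invFun := fun p => ⟨_, h2 p.1 p.2⟩
      left_inv := fun p => Subtype.ext (Prod.ext rfl (by simp [mul_assoc]))
      right_inv := fun p => Subtype.ext (Prod.ext rfl (by simp [mul_assoc]))
      map_mul' := fun p q => Subtype.ext (Prod.ext rfl (by
        change U * (p.1.2 * q.1.2) * U⁻¹ = (U * p.1.2 * U⁻¹) * (U * q.1.2 * U⁻¹)
        group)) }
  have hc2 : Continuous fun p : pullbackGroup α => p.1.2 :=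
    continuous_snd.comp continuous_subtype_val
  have hc2' : Continuous fun p : pullbackGroup β => p.1.2 :=
    continuous_snd.comp continuous_subtype_val
  refine ⟨⟨φ, ?_, rfl⟩, ?_, ?_⟩
  · funext z
    refine Subtype.ext (Prod.ext rfl ?_)
    change U * scalar H z * U⁻¹ = scalar H z
    rw [← scalar_comm, mul_inv_cancel_right]
  · exact Continuous.subtype_mk ((continuous_fst.comp continuous_subtype_val).prodMk
      ((continuous_const.mul hc2).mul continuous_const)) _
  · exact Continuous.subtype_mk ((continuous_fst.comp continuous_subtype_val).prodMk
      ((continuous_const.mul hc2').mul continuous_const)) _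

/-- Stable homomorphisms with isomorphic pullback extensions are conjugate. -/
theorem conj_of_pullbackExtension_iso [CompactSpace G] [CompleteSpace H]
    [TopologicalSpace.SeparableSpace H] {α β : G →ₜ* PUH H} (hα : IsStable α) (hβ : IsStable β)
    (h : (pullbackExtension α).Iso (pullbackExtension β)) :
    ∃ F : PUH H, ∀ g, F * α g * F⁻¹ = β g := by
  obtain ⟨φ, hφ, hφ'⟩ := h
  -- Pulling β̃ back along the isomorphism gives two stable representations of one group; the class
  -- in PU(H) of a unitary intertwiner is the conjugating element.
  let ρ : (pullbackExtension α).E →ₜ* UH H :=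
    ⟨(lift β).toMonoidHom.comp φ.toMulEquiv.toMonoidHom, (lift β).continuous_toFun.comp hφ⟩
  have hρ : IsStableOn ρ (scalarIrreps (pullbackExtension α)) :=
    IsStableOn.of_iso φ hφ' (fun _ => rfl) hβ
  obtain ⟨F, hF⟩ := (pullbackExtension α).exists_unitary_of_isStableOn hα hρ
  refine ⟨F, fun g => ?_⟩
  obtain ⟨e, he⟩ := pullbackProj_surjective α g
  have h1 : α g = (e.1.2 : PUH H) := he ▸ mem_pullbackGroup.1 e.2
  have h2 : (φ.toMulEquiv e).1.1 = g := (congrFun φ.rightHom_comm e).trans he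
  have h3 : β g = ((φ.toMulEquiv e).1.2 : PUH H) := h2 ▸ mem_pullbackGroup.1 (φ.toMulEquiv e).2
  have h4 : F * e.1.2 = (φ.toMulEquiv e).1.2 * F := hF e
  rw [h1, h3, mul_inv_eq_iff_eq_mul]
  exact congrArg (QuotientGroup.mk : UH H → PUH H) h4

end Conjugacy

/-! ### Separable infinite-dimensional Hilbert spaces -/

section HilbertSpaces

/-- Separability makes a Hilbert basis countable. It is not finite, because a finite span is closed
and would then be the whole space. -/
theorem exists_hilbertBasis_nat (H : Type v) [NormedAddCommGroup H] [InnerProductSpace ℂ H]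
    [CompleteSpace H] [TopologicalSpace.SeparableSpace H] (hH : ¬ FiniteDimensional ℂ H) :
    Nonempty (HilbertBasis ℕ ℂ H) := by
  obtain ⟨s, b, hb⟩ := exists_hilbertBasis ℂ H
  have hc : Countable s := countable_of_orthonormal b.orthonormal
  have hi : Infinite s := by
    by_contra hfin
    rw [not_infinite_iff_finite] at hfin
    have h1 := b.dense_span
    have : FiniteDimensional ℂ (Submodule.span ℂ (Set.range b)) :=
      FiniteDimensional.span_of_finite ℂ (Set.finite_range _)
    rw [IsClosed.submodule_topologicalClosure_eq
      (Submodule.closed_of_finiteDimensional _)] at h1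
    rw [h1] at this
    exact hH (Module.Finite.equiv (Submodule.topEquiv (R := ℂ) (M := H)))
  obtain ⟨e⟩ : Nonempty (ℕ ≃ s) := nonempty_equiv_of_countable
  refine ⟨HilbertBasis.mk (b.orthonormal.comp e e.injective) ?_⟩
  rw [e.surjective.range_comp, b.dense_span]

theorem exists_linearIsometryEquiv {H : Type v} {K : Type w} [NormedAddCommGroup H]
    [InnerProductSpace ℂ H] [CompleteSpace H] [TopologicalSpace.SeparableSpace H]
    [NormedAddCommGroup K] [InnerProductSpace ℂ K] [CompleteSpace K]
    [TopologicalSpace.SeparableSpace K] (hH : ¬ FiniteDimensional ℂ H)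
    (hK : ¬ FiniteDimensional ℂ K) : Nonempty (K ≃ₗᵢ[ℂ] H) := by
  obtain ⟨b⟩ := exists_hilbertBasis_nat H hH
  obtain ⟨c⟩ := exists_hilbertBasis_nat K hK
  exact ⟨c.repr.trans b.repr.symm⟩

end HilbertSpaces

/-! ### Weight-one functions and the vector-valued regular representation -/

section Regular

open MeasureTheory

variable {G : Type u} [Group G] [TopologicalSpace G]
  {H : Type v} [NormedAddCommGroup H] [InnerProductSpace ℂ H]

/-- Extend z ↦ z⁻¹ from the closed circle to the whole group by Tietze, then project to weight one
by averaging over the circle. At the identity the averaged integrand is z·z⁻¹ = 1. -/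
theorem CircleExtension.exists_weight_function [CompactSpace G] (X : CircleExtension.{u, w} G)
    [SecondCountableTopology X.E] :
    ∃ χ : C(X.E, ℂ), χ 1 ≠ 0 ∧ ∀ (z : Circle) (x : X.E), χ ((X.ext.inl z)⁻¹ * x) = z * χ x := by
  borelize Circle
  obtain ⟨μ, hμ, hμ', -⟩ := exists_probability_haar (E := Circle)
  obtain ⟨f, hf⟩ := ContinuousMap.exists_extension X.isSES.isClosedEmbedding
    (⟨fun z => ((z⁻¹ : Circle) : ℂ), by fun_prop⟩ : C(Circle, ℂ))
  have hf' : ∀ z : Circle, f (X.ext.inl z) = ((z⁻¹ : Circle) : ℂ) := fun z =>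
    congrArg (fun g : C(Circle, ℂ) => g z) hf
  have hinl := X.continuous_inl
  have hcont : Continuous fun p : X.E × Circle => (p.2 : ℂ) * f (X.ext.inl p.2 * p.1) := by
    fun_prop
  refine ⟨⟨fun x => ∫ z : Circle, (z : ℂ) * f (X.ext.inl z * x) ∂μ, ?_⟩, ?_, ?_⟩
  · have := continuous_parametric_integral_of_continuous (μ := μ)
      (f := fun (x : X.E) (z : Circle) => (z : ℂ) * f (X.ext.inl z * x)) hcont isCompact_univ
    simpa using this
  · change ∫ z : Circle, (z : ℂ) * f (X.ext.inl z * 1) ∂μ ≠ 0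
    simp [hf']
  · intro z x
    change ∫ w : Circle, (w : ℂ) * f (X.ext.inl w * ((X.ext.inl z)⁻¹ * x)) ∂μ =
      z * ∫ w : Circle, (w : ℂ) * f (X.ext.inl w * x) ∂μ
    -- Substituting w ↦ zw extracts the factor z; by centrality the two copies of z inside `f`
    -- cancel.
    rw [← integral_mul_left_eq_self _ z, ← integral_const_mul]
    congr 1
    funext w
    rw [X.ext.inl.map_mul, Circle.coe_mul, mul_assoc, ← mul_assoc (X.ext.inl z * X.ext.inl w),
      X.central z (X.ext.inl w), mul_inv_cancel_right]

variable {E : Type w} [Group E] [TopologicalSpace E] [CompactSpace E]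
  [SecondCountableTopology E] [MeasurableSpace E] [BorelSpace E] (μ : Measure E)
  [μ.IsHaarMeasure]

/-- The continuous function `x ↦ c x • y`. -/
def tensorCont (H : Type v) [NormedAddCommGroup H] [InnerProductSpace ℂ H] (c : C(E, ℂ)) :
    H →ₗ[ℂ] C(E, H) where
  toFun y := ⟨fun x => c x • y, by fun_prop⟩
  map_add' y y' := ContinuousMap.ext fun x => smul_add (c x) y y'
  map_smul' a y := ContinuousMap.ext fun x => smul_comm (c x) a y

/-- The square-integrable function `x ↦ c x • y`. -/
def tensorLp (H : Type v) [NormedAddCommGroup H] [InnerProductSpace ℂ H] (c : C(E, ℂ)) :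
    H →ₗ[ℂ] Lp H 2 μ :=
  (ContinuousMap.toLp 2 μ ℂ).toLinearMap.comp
    (tensorCont H c)

theorem coeFn_tensorLp (c : C(E, ℂ)) (y : H) : tensorLp μ H c y =ᵐ[μ] fun x => c x • y :=
  ContinuousMap.coeFn_toLp μ _

/-- Haar measure charges every nonempty open set, so continuous functions that agree almost
everywhere agree at the point where `c` does not vanish. -/
theorem tensorLp_injective {c : C(E, ℂ)} {x : E} (hc : c x ≠ 0) :
    Function.Injective (tensorLp μ H c) := by
  intro y y' h
  have h1 : tensorCont H c y = tensorCont H c y' :=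
    ContinuousMap.toLp_injective (p := 2) (𝕜 := ℂ) μ h
  have h2 : c x • y = c x • y' := congrArg (fun F : C(E, H) => F x) h1
  exact (smul_right_injective H hc) h2

theorem tensorLp_add (c c' : C(E, ℂ)) (y : H) :
    tensorLp μ H (c + c') y = tensorLp μ H c y + tensorLp μ H c' y := by
  have h : tensorCont H (c + c') y = tensorCont H c y + tensorCont H c' y :=
    ContinuousMap.ext fun x => add_smul (c x) (c' x) y
  simp only [tensorLp, LinearMap.comp_apply, h, map_add]

theorem tensorLp_smul (a : ℂ) (c : C(E, ℂ)) (y : H) :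
    tensorLp μ H (a • c) y = a • tensorLp μ H c y := by
  have h : tensorCont H (a • c) y = a • tensorCont H c y :=
    ContinuousMap.ext fun x => mul_smul a (c x) y
  simp only [tensorLp, LinearMap.comp_apply, h, map_smul]

variable [IsTopologicalGroup E]

theorem mk_smul_tensorLp (g : E) (c : C(E, ℂ)) (y : H) :
    DomMulAct.mk g • tensorLp μ H c y =
      tensorLp μ H (c.comp ⟨fun x => g * x, continuous_const_mul g⟩) y := by
  refine Lp.ext ?_
  refine (DomMulAct.smul_Lp_ae_eq _ _).trans (Filter.EventuallyEq.trans ?_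
    (coeFn_tensorLp μ _ y).symm)
  exact (measurePreserving_smul g μ).quasiMeasurePreserving.ae_eq_comp (coeFn_tensorLp μ c y)

/-- The left regular representation on the square-integrable functions. -/
def regularRep [T2Space E] (H : Type v) [NormedAddCommGroup H] [InnerProductSpace ℂ H] [μ.Regular] :
    E →ₜ* UH (Lp H 2 μ) where
  toFun g :=
    { toFun := fun f => DomMulAct.mk g⁻¹ • f
      invFun := fun f => DomMulAct.mk g • f
      map_add' := fun f f' => smul_add _ f f'
      map_smul' := fun c f => smul_comm _ c f
      left_inv := fun f => by
        change DomMulAct.mk g • DomMulAct.mk g⁻¹ • f = f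
        rw [smul_smul, ← DomMulAct.mk_mul]; simp
      right_inv := fun f => by
        change DomMulAct.mk g⁻¹ • DomMulAct.mk g • f = f
        rw [smul_smul, ← DomMulAct.mk_mul]; simp
      norm_map' := fun f => DomMulAct.norm_smul_Lp _ f }
  map_one' := LinearIsometryEquiv.ext fun f => by
    change DomMulAct.mk (1 : E)⁻¹ • f = f
    simp
  map_mul' g h := LinearIsometryEquiv.ext fun f => by
    change DomMulAct.mk (g * h)⁻¹ • f = DomMulAct.mk g⁻¹ • DomMulAct.mk h⁻¹ • f
    rw [smul_smul, ← DomMulAct.mk_mul, mul_inv_rev]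
  continuous_toFun := by
    rw [continuous_UH_iff]
    intro f
    change Continuous fun g : E => DomMulAct.mk g⁻¹ • f
    have : Fact ((2 : ENNReal) ≠ ⊤) := ⟨by norm_num⟩
    have h1 : Continuous fun g : E => DomMulAct.mk g⁻¹ :=
      DomMulAct.continuous_mk.comp continuous_inv
    exact h1.smul continuous_const

end Regular

/-! ### Realizing every extension by a stable homomorphism -/

section Realization

open MeasureTheory

variable {G : Type u} [Group G] [TopologicalSpace G]
  {H : Type v} [NormedAddCommGroup H] [InnerProductSpace ℂ H]

/-- Because of the inverse in the argument, left translation of the coefficient of v by g is the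
coefficient of gv. Thus v ↦ c v is equivariant for the left regular action. -/
theorem Irrep.exists_coefficient {E : Type w} [Group E] [TopologicalSpace E]
    [IsTopologicalGroup E] (V : Irrep E) (v₀ : EuclideanSpace ℂ (Fin V.dim)) :
    ∃ c : EuclideanSpace ℂ (Fin V.dim) →ₗ[ℂ] C(E, ℂ),
      ∀ v x, c v x = inner ℂ v₀ (V.hom x⁻¹ v) :=
  ⟨{ toFun := fun v => ⟨fun x => inner ℂ v₀ (V.hom x⁻¹ v),
        continuous_const.inner ((continuous_apply_hom V.hom v).comp continuous_inv)⟩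
     map_add' := fun v v' => ContinuousMap.ext fun x => by simp
     map_smul' := fun a v => ContinuousMap.ext fun x => by simp },
    fun _ _ => rfl⟩

/-- Every extension has a stable representation on a given separable Hilbert space. -/
theorem CircleExtension.exists_isStableOn [CompactSpace G] [CompleteSpace H]
    [TopologicalSpace.SeparableSpace H] (hH : ¬ FiniteDimensional ℂ H)
    (X : CircleExtension.{u, w} G) [SecondCountableTopology X.E] :
    ∃ ρ : X.E →ₜ* UH H, (∀ z, ρ (X.ext.inl z) = scalar H z) ∧
      IsStableOn ρ (scalarIrreps X) := by
  borelize X.E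
  obtain ⟨μ, hμ, hμ', hμr⟩ := exists_probability_haar (E := X.E)
  let R := regularRep μ H
  have hR : ∀ (g : X.E) (c : C(X.E, ℂ)) (y : H), R g (tensorLp μ H c y) =
      tensorLp μ H (c.comp ⟨fun x => g⁻¹ * x, continuous_const_mul g⁻¹⟩) y :=
    fun g c y => mk_smul_tensorLp μ g⁻¹ c y
  -- The weight-one part: a closed subspace, invariant because the circle is central.
  let K : Submodule ℂ (Lp H 2 μ) :=
    { carrier := {f | ∀ z : Circle, R (X.ext.inl z) f = (z : ℂ) • f}
      add_mem' := fun {f f'} hf hf' z => by rw [map_add, hf, hf', smul_add]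
      zero_mem' := fun z => by rw [map_zero, smul_zero]
      smul_mem' := fun a f hf z => by rw [map_smul, hf, smul_comm] }
  have hK : ∀ f, f ∈ K ↔ ∀ z : Circle, R (X.ext.inl z) f = (z : ℂ) • f := fun f => Iff.rfl
  have hKclosed : IsClosed (K : Set (Lp H 2 μ)) := by
    have h1 : (K : Set (Lp H 2 μ)) = ⋂ z : Circle, {f | R (X.ext.inl z) f = (z : ℂ) • f} := by
      ext f
      simp [hK]
    rw [h1]
    exact isClosed_iInter fun z => isClosed_eq (R (X.ext.inl z)).continuous (by fun_prop)
  have hKinv : ∀ g, ∀ f ∈ K, R g f ∈ K := fun g f hf z => by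
    rw [← UH.mul_apply, ← map_mul, X.central, map_mul, UH.mul_apply, hf z, map_smul]
  have hKtensor : ∀ (c : C(X.E, ℂ)) (y : H),
      (∀ (z : Circle) (x : X.E), c ((X.ext.inl z)⁻¹ * x) = z * c x) → tensorLp μ H c y ∈ K := by
    intro c y hc z
    rw [hR, ← tensorLp_smul]
    congr 2
    ext x
    exact hc z x
  have : CompleteSpace K := hKclosed.completeSpace_coe
  -- Tensoring a nonzero scalar function of weight one with vectors embeds `H` into `K`.
  have hKinf : ¬ FiniteDimensional ℂ K := by
    intro hfin
    obtain ⟨χ, hχ1, hχ⟩ := X.exists_weight_function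
    have hinj : Function.Injective
        ((tensorLp μ H χ).codRestrict K fun y => hKtensor χ y hχ) := fun y y' h =>
      tensorLp_injective μ hχ1 (congrArg Subtype.val h)
    exact hH (FiniteDimensional.of_injective _ hinj)
  have : Fact ((2 : ENNReal) ≠ ⊤) := ⟨by norm_num⟩
  have : SecondCountableTopology (Lp H 2 μ) := Lp.SecondCountableTopology
  obtain ⟨e⟩ := exists_linearIsometryEquiv hH hKinf
  let j : H →ₗᵢ[ℂ] Lp H 2 μ := K.subtypeₗᵢ.comp e.symm.toLinearIsometry
  have hjK : ∀ x, j x ∈ K := fun x => (e.symm x).2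
  have hje : ∀ k : K, j (e k) = k := fun k => by simp [j]
  obtain ⟨ρ, hρ⟩ := exists_hom_of_linearIsometry R j fun g x =>
    ⟨_, hje ⟨_, hKinv g _ (hjK x)⟩⟩
  have hρz : ∀ z, ρ (X.ext.inl z) = scalar H z := fun z =>
    LinearIsometryEquiv.ext fun x => j.injective (by
      rw [hρ, hjK x z, scalar_apply, map_smul])
  refine ⟨ρ, hρz, fun V hV => ?_, fun V hV => ?_⟩
  · obtain ⟨v₀, hv₀⟩ := V.exists_ne_zero
    obtain ⟨c, hc⟩ := V.exists_coefficient v₀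
    have hcg : ∀ g v, (c v).comp ⟨fun x => g⁻¹ * x, continuous_const_mul g⁻¹⟩ =
        c (V.hom g v) := fun g v => by
      ext x
      simp [hc, UH.mul_apply]
    have hcK : ∀ v y, tensorLp μ H (c v) y ∈ K := fun v y => hKtensor _ _ fun z x => by
      have h1 := congrArg (fun F : C(X.E, ℂ) => F x) (hcg (X.ext.inl z) v)
      change c v ((X.ext.inl z)⁻¹ * x) = _ at h1
      rw [h1, hV z, scalar_apply, map_smul]
      rfl
    -- Each vector `y` of `H` gives an embedding of `V`; letting `y` vary makes the isotypical
    -- component infinite dimensional. Taking values in `H` serves this purpose.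
    let T (y : H) : Representation.IntertwiningMap (toRep V.hom.toMonoidHom)
        (toRep ρ.toMonoidHom) :=
      LinearMap.intertwiningMap_of_isIntertwiningMap _ _
        { toFun := fun v => e ⟨tensorLp μ H (c v) y, hcK v y⟩
          map_add' := fun v v' => j.injective (by simp [hje, tensorLp_add])
          map_smul' := fun a v => j.injective (by simp [hje, tensorLp_smul]) }
        fun g v => j.injective (by
          change j (e ⟨tensorLp μ H (c (V.hom g v)) y, _⟩) =
            j (ρ g (e ⟨tensorLp μ H (c v) y, _⟩))
          rw [hρ, hje, hje, hR, hcg])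
    have hmem : ∀ y, e ⟨tensorLp μ H (c v₀) y, hcK v₀ y⟩ ∈ isotypic ρ V := fun y =>
      Submodule.mem_iSup_of_mem (T y) ⟨v₀, rfl⟩
    let Ψ : H →ₗ[ℂ] isotypic ρ V :=
      (e.toLinearEquiv.toLinearMap.comp
        ((tensorLp μ H (c v₀)).codRestrict K (hcK v₀))).codRestrict _ hmem
    have hΨ : Function.Injective Ψ := fun y y' h => by
      have h1 := e.injective (congrArg Subtype.val h)
      -- At the identity the coefficient of `v₀` is ⟨v₀, v₀⟩ ≠ 0.
      refine tensorLp_injective μ (x := 1) (c := c v₀) ?_ (congrArg Subtype.val h1)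
      rw [hc]
      simpa using hv₀
    exact fun hfin => hH (FiniteDimensional.of_injective Ψ hΨ)
  · refine le_bot_iff.1 (iSup_le fun T => ?_)
    have hirr := V.irreducible
    rcases Representation.IsIrreducible.injective_or_eq_zero T with hT | hT
    -- An injective intertwiner transfers the scalar circle action from `H` to `V`, contrary to the
    -- choice of `V`.
    · exact absurd (fun z => LinearIsometryEquiv.ext fun v => hT (by
        have h1 := Representation.IntertwiningMap.isIntertwining _ _ T (X.ext.inl z) v
        change T (V.hom (X.ext.inl z) v) = ρ (X.ext.inl z) (T v) at h1
        rw [h1, hρz, scalar_apply, scalar_apply, map_smul])) hV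
    · rw [hT]
      rintro _ ⟨x, rfl⟩
      exact Submodule.zero_mem _

/-- Every extension with second countable total group is the pullback extension of a stable
homomorphism. -/
theorem CircleExtension.exists_stable [IsTopologicalGroup G] [T2Space G] [CompactSpace G]
    [CompleteSpace H] [TopologicalSpace.SeparableSpace H] [Nontrivial H]
    (hH : ¬ FiniteDimensional ℂ H) (X : CircleExtension.{u, max u v} G)
    [SecondCountableTopology X.E] :
    ∃ α : G →ₜ* PUH H, IsStable α ∧ X.Iso (pullbackExtension α) := by
  obtain ⟨ρ, hρz, hρ⟩ := X.exists_isStableOn hH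
  let σ : X.E →* PUH H := (QuotientGroup.mk' _).comp ρ.toMonoidHom
  have hσ : ∀ e, σ e = (ρ e : PUH H) := fun _ => rfl
  have hker : X.ext.rightHom.ker ≤ σ.ker := by
    rw [← X.ext.range_inl_eq_ker_rightHom]
    rintro _ ⟨z, rfl⟩
    rw [MonoidHom.mem_ker, hσ, hρz, coe_scalar]
  let α₀ : G →* PUH H := X.ext.rightHom.liftOfSurjective X.ext.rightHom_surjective ⟨σ, hker⟩
  have hα₀ : ∀ e, α₀ (X.ext.rightHom e) = (ρ e : PUH H) := fun e =>
    MonoidHom.liftOfRightInverse_comp_apply _ _ _ ⟨σ, hker⟩ e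
  let α : G →ₜ* PUH H := ⟨α₀, by
    refine X.isSES.isOpenQuotientMap.isQuotientMap.continuous_iff.2 ?_
    have h1 : Continuous fun e => (ρ e : PUH H) :=
      QuotientGroup.continuous_mk.comp ρ.continuous_toFun
    exact h1.congr fun e => (hα₀ e).symm⟩
  -- The map e ↦ (p(e), ρ(e)) is bijective because the circle acts by the same scalars on both
  -- sides; a continuous bijection from a compact to a Hausdorff space is a homeomorphism.
  let ψ₀ : X.E →* (pullbackExtension α).E :=
    (X.ext.rightHom.prod ρ.toMonoidHom).codRestrict (pullbackGroup α) fun e => hα₀ e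
  have hψcont : Continuous ψ₀ :=
    Continuous.subtype_mk (X.continuous_rightHom.prodMk ρ.continuous_toFun) _
  have hψ : Function.Bijective ψ₀ := by
    constructor
    · rw [injective_iff_map_eq_one]
      intro e he
      have h1 : X.ext.rightHom e = 1 := congrArg (fun p : pullbackGroup α => p.1.1) he
      have h2 : ρ e = 1 := congrArg (fun p : pullbackGroup α => p.1.2) he
      obtain ⟨z, hz⟩ := X.exists_inl_of_rightHom_eq (h1.trans (map_one X.ext.rightHom).symm)
      rw [mul_one] at hz
      rw [hz, hρz, ← map_one (scalar H)] at h2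
      rw [hz, scalar_injective h2, map_one]
    · rintro ⟨⟨g, T⟩, hp⟩
      obtain ⟨e, rfl⟩ := X.ext.rightHom_surjective g
      have h1 : (ρ e : PUH H) = (T : PUH H) := (hα₀ e).symm.trans hp
      obtain ⟨z, hz⟩ := QuotientGroup.eq.1 h1
      refine ⟨e * X.ext.inl z, Subtype.ext (Prod.ext ?_ ?_)⟩
      · change X.ext.rightHom (e * X.ext.inl z) = X.ext.rightHom e
        rw [map_mul, X.rightHom_inl, mul_one]
      · change ρ (e * X.ext.inl z) = T
        rw [map_mul, hρz, hz, mul_inv_cancel_left]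
  let ψ : X.E ≃* (pullbackExtension α).E := MulEquiv.ofBijective ψ₀ hψ
  have hψsymm : Continuous ψ.symm :=
    Continuous.continuous_symm_of_equiv_compact_to_t2 (f := ψ.toEquiv) hψcont
  let φ : X.ext.Equiv (pullbackExtension α).ext := ⟨ψ, by
    funext z
    refine Subtype.ext (Prod.ext ?_ ?_)
    · exact X.rightHom_inl z
    · exact hρz z, rfl⟩
  have hiso : X.Iso (pullbackExtension α) := ⟨φ, hψcont, hψsymm⟩
  refine ⟨α, ?_, hiso⟩
  let φ' : (pullbackExtension α).ext.Equiv X.ext := ⟨ψ.symm, by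
    funext z
    change ψ.symm _ = _
    rw [MulEquiv.symm_apply_eq]
    exact (congrFun φ.inl_comm z).symm, by
    funext p
    obtain ⟨e, rfl⟩ := ψ.surjective p
    change X.ext.rightHom (ψ.symm (ψ e)) = _
    rw [ψ.symm_apply_apply]
    rfl⟩
  refine IsStableOn.of_iso φ' hψcont (fun p => ?_) hρ
  obtain ⟨e, rfl⟩ := ψ.surjective p
  change ρ e = ρ (ψ.symm (ψ e))
  rw [ψ.symm_apply_apply]

end Realization

/-! ### Continuous homomorphisms to Banach algebras are smooth -/

section Smoothing

open MeasureTheory Set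

variable {n : ℕ} {G : Type u} [Group G] [TopologicalSpace G]
  [ChartedSpace (EuclideanSpace ℝ (Fin n)) G] [LieGroup (𝓡 n) ∞ G]
  [T2Space G] [MeasurableSpace G] [BorelSpace G]
  {A : Type v} [NormedAddCommGroup A] [NormedSpace ℝ A]

/-- Convolution with a smooth function supported near the identity is smooth near the identity. -/
theorem contMDiffAt_one_convolution {μ : Measure G} [IsFiniteMeasureOnCompacts μ]
    {f : G → ℝ} (hf : ContMDiff (𝓡 n) 𝓘(ℝ, ℝ) ∞ f)
    {C N : Set G} (hC : IsCompact C) (hCS : C ⊆ (extChartAt (𝓡 n) (1 : G)).source)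
    (hN : IsOpen N) (hN1 : 1 ∈ N) (hNC : N ⊆ C)
    (hfC : ∀ g ∈ N, ∀ h, f (g⁻¹ * h) ≠ 0 → h ∈ C) {σ : G → A} (hσ : Continuous σ) :
    ContMDiffAt (𝓡 n) 𝓘(ℝ, A) ∞ (fun g => ∫ h, f (g⁻¹ * h) • σ h ∂μ) 1 := by
  classical
  set c := extChartAt (𝓡 n) (1 : G) with hc
  have hcont : ContinuousOn c c.source := continuousOn_extChartAt (1 : G)
  have hcont' : ContinuousOn c.symm c.target := continuousOn_extChartAt_symm (1 : G)
  have htarget : IsOpen c.target := isOpen_extChartAt_target (1 : G)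
  have hsm : ContMDiffOn 𝓘(ℝ, EuclideanSpace ℝ (Fin n)) (𝓡 n) ∞ c.symm c.target :=
    contMDiffOn_extChartAt_symm (1 : G)
  have hcC : IsCompact (c '' C) := hC.image_of_continuousOn (hcont.mono hCS)
  have hcCt : c '' C ⊆ c.target := by
    rintro _ ⟨g, hg, rfl⟩
    exact c.map_source (hCS hg)
  let s : Set (EuclideanSpace ℝ (Fin n)) := c.target ∩ c.symm ⁻¹' N
  have hs : IsOpen s := hcont'.isOpen_inter_preimage htarget hN
  -- The integral is moved to Euclidean space by pushing μ forward along the chart. The variable g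
  -- enters only through `f`, so σ need only be continuous.
  let ν : Measure (EuclideanSpace ℝ (Fin n)) := (μ.restrict C).map c
  have hfin : IsFiniteMeasure (μ.restrict C) := ⟨by
    rw [Measure.restrict_apply_univ]
    exact hC.measure_lt_top⟩
  have hcm : AEMeasurable c (μ.restrict C) :=
    (hcont.mono hCS).aemeasurable hC.measurableSet
  let τ : EuclideanSpace ℝ (Fin n) → A := (c '' C).indicator fun t => σ (c.symm t)
  have hτc : ContinuousOn (fun t => σ (c.symm t)) (c '' C) :=
    hσ.comp_continuousOn (hcont'.mono hcCt)
  have hτm : ∀ ν' : Measure (EuclideanSpace ℝ (Fin n)), AEStronglyMeasurable τ ν' := fun ν' => by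
    rw [aestronglyMeasurable_indicator_iff hcC.measurableSet]
    exact hτc.aestronglyMeasurable hcC.measurableSet
  have hτi : LocallyIntegrable τ ν := by
    obtain ⟨B, hB⟩ := hcC.exists_bound_of_continuousOn hτc
    refine Integrable.locallyIntegrable ?_
    refine Integrable.of_bound (hτm ν) (max B 0) (Filter.Eventually.of_forall fun t => ?_)
    by_cases ht : t ∈ c '' C
    · simp only [τ, indicator_of_mem ht]
      exact (hB t ht).trans (le_max_left _ _)
    · simp [τ, indicator_of_notMem ht]
  let K : EuclideanSpace ℝ (Fin n) → EuclideanSpace ℝ (Fin n) → ℝ := fun p t =>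
    if t ∈ c.target then f ((c.symm p)⁻¹ * c.symm t) else 0
  have hK0 : ∀ p ∈ s, ∀ t, t ∉ c '' C → K p t = 0 := by
    intro p hp t ht
    by_cases htt : t ∈ c.target
    · simp only [K, if_pos htt]
      by_contra hne
      exact ht ⟨c.symm t, hfC _ hp.2 _ hne, c.right_inv htt⟩
    · simp only [K, if_neg htt]
  -- The open sets `c.target` and the complement of `c '' C` cover the space. On the first the
  -- kernel is given by smooth maps, on the second it is zero, so extending by 0 preserves
  -- smoothness.
  have hKsm : ContDiffOn ℝ ∞ (fun q : EuclideanSpace ℝ (Fin n) × EuclideanSpace ℝ (Fin n) =>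
      K q.1 q.2) (s ×ˢ univ) := by
    have hunion : s ×ˢ (univ : Set (EuclideanSpace ℝ (Fin n))) =
        s ×ˢ c.target ∪ s ×ˢ (c '' C)ᶜ := by
      rw [← prod_union]
      congr 1
      refine (eq_univ_of_forall fun t => ?_).symm
      by_cases ht : t ∈ c '' C
      · exact Or.inl (hcCt ht)
      · exact Or.inr ht
    rw [hunion]
    refine ContDiffOn.union_of_isOpen ?_ ?_ (hs.prod htarget)
      (hs.prod hcC.isClosed.isOpen_compl)
    · have h1 : ContDiffOn ℝ ∞ (fun q : EuclideanSpace ℝ (Fin n) × EuclideanSpace ℝ (Fin n) =>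
          f ((c.symm q.1)⁻¹ * c.symm q.2)) (s ×ˢ c.target) := by
        rw [← contMDiffOn_iff_contDiffOn]
        have h2 : ContMDiffOn 𝓘(ℝ, EuclideanSpace ℝ (Fin n) × EuclideanSpace ℝ (Fin n)) (𝓡 n) ∞
            (fun q : EuclideanSpace ℝ (Fin n) × EuclideanSpace ℝ (Fin n) => c.symm q.1)
            (s ×ˢ c.target) :=
          hsm.comp contDiff_fst.contMDiff.contMDiffOn fun q hq => hq.1.1
        have h3 : ContMDiffOn 𝓘(ℝ, EuclideanSpace ℝ (Fin n) × EuclideanSpace ℝ (Fin n)) (𝓡 n) ∞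
            (fun q : EuclideanSpace ℝ (Fin n) × EuclideanSpace ℝ (Fin n) => c.symm q.2)
            (s ×ˢ c.target) :=
          hsm.comp contDiff_snd.contMDiff.contMDiffOn fun q hq => hq.2
        exact hf.comp_contMDiffOn (h2.inv.mul h3)
      refine h1.congr fun q hq => ?_
      simp only [K, if_pos hq.2]
    · exact contDiffOn_const.congr fun q hq => hK0 q.1 hq.1 q.2 hq.2
  -- The parametric integral is a convolution evaluated at the constant point 0; the sign in K p
  -- (-t) undoes the reflection 0 - t.
  have hconv := contDiffOn_convolution_right_with_param_comp (μ := ν) (n := ⊤)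
    (ContinuousLinearMap.lsmul ℝ ℝ (E := A)).flip (v := fun _ => 0) contDiffOn_const
    (f := τ) (g := fun p t => K p (-t)) hs hcC.neg
    (fun p t hp ht => hK0 p hp _ fun h => ht (by simpa using h)) hτi
    (hKsm.comp (contDiff_fst.prodMk contDiff_snd.neg).contDiffOn fun q hq => ⟨hq.1, mem_univ _⟩)
  have heq : ∀ g ∈ N, ∫ h, f (g⁻¹ * h) • σ h ∂μ =
      convolution τ (fun t => K (c g) (-t)) (ContinuousLinearMap.lsmul ℝ ℝ (E := A)).flip ν 0 := by
    intro g hg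
    have hgs : c.symm (c g) = g := c.left_inv (hCS (hNC hg))
    have hp : c g ∈ s := ⟨c.map_source (hCS (hNC hg)), by
      rw [mem_preimage, hgs]
      exact hg⟩
    simp only [convolution, zero_sub, neg_neg, ContinuousLinearMap.flip_apply,
      ContinuousLinearMap.lsmul_apply]
    have hKm : AEStronglyMeasurable (fun t => K (c g) t) ν := by
      have : ContDiffOn ℝ ∞ (fun t => K (c g) t) univ :=
        hKsm.comp (contDiff_const.prodMk contDiff_id).contDiffOn fun t _ => ⟨hp, mem_univ _⟩
      exact (contDiffOn_univ.1 this).continuous.aestronglyMeasurable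
    rw [show ∫ t, K (c g) t • τ t ∂ν = _ from integral_map hcm (hKm.smul (hτm ν))]
    rw [← setIntegral_eq_integral_of_forall_compl_eq_zero (s := C)]
    · refine setIntegral_congr_fun hC.measurableSet fun h hh => ?_
      have h1 : c h ∈ c.target := c.map_source (hCS hh)
      simp only [K, τ, if_pos h1, indicator_of_mem (mem_image_of_mem c hh), hgs,
        c.left_inv (hCS hh)]
    · intro h hh
      by_contra hne
      exact hh (hfC g hg h fun h0 => hne (by rw [h0, zero_smul]))
  have h1s : c 1 ∈ s := ⟨c.map_source (hCS (hNC hN1)), by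
    rw [mem_preimage, c.left_inv (hCS (hNC hN1))]
    exact hN1⟩
  have h2 := ContMDiffAt.comp (1 : G) (I := 𝓡 n) (f := c)
    (g := fun p => convolution τ (fun t => K p (-t))
      (ContinuousLinearMap.lsmul ℝ ℝ (E := A)).flip ν 0)
    (hconv.contDiffAt (hs.mem_nhds h1s)).contMDiffAt
    (contMDiffAt_extChartAt (I := 𝓡 n) (x := (1 : G)))
  exact h2.congr_of_eventuallyEq (Filter.mem_of_superset (hN.mem_nhds hN1) heq)

omit [MeasurableSpace G] [BorelSpace G] in
/-- A continuous homomorphism to the multiplicative monoid of a Banach algebra is smooth. -/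
theorem contMDiff_of_continuous_monoidHom {A : Type v} [NormedRing A] [NormedAlgebra ℝ A]
    [CompleteSpace A] [IsTopologicalGroup G] [CompactSpace G] (σ : G →* A) (hσ : Continuous σ) :
    ContMDiff (𝓡 n) 𝓘(ℝ, A) ∞ σ := by
  have hmul : ∀ a : A, ContMDiff 𝓘(ℝ, A) 𝓘(ℝ, A) ∞ fun x => x * a := fun a =>
    (contDiff_id.mul contDiff_const).contMDiff
  have hmul' : ∀ a : A, ContMDiff 𝓘(ℝ, A) 𝓘(ℝ, A) ∞ fun x => a * x := fun a =>
    (contDiff_const.mul contDiff_id).contMDiff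
  -- Smoothness at 1 suffices: near g₀ one has σ(g) = σ(g₀)σ(g₀⁻¹g).
  suffices h1 : ContMDiffAt (𝓡 n) 𝓘(ℝ, A) ∞ σ 1 by
    intro g₀
    have h2 : ContMDiffAt (𝓡 n) (𝓡 n) ∞ (fun g => g₀⁻¹ * g) g₀ := contMDiff_mul_left.contMDiffAt
    have h3 : ContMDiffAt (𝓡 n) 𝓘(ℝ, A) ∞ σ (g₀⁻¹ * g₀) := by rwa [inv_mul_cancel]
    have h4 := ((hmul' (σ g₀)).contMDiffAt).comp g₀ (h3.comp g₀ h2)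
    refine h4.congr_of_eventuallyEq (Filter.Eventually.of_forall fun g => ?_)
    simp [← map_mul]
  borelize G
  obtain ⟨μ, hμ, hμ', -⟩ := exists_probability_haar (E := G)
  have hsource : (extChartAt (𝓡 n) (1 : G)).source ∈ 𝓝 (1 : G) := extChartAt_source_mem_nhds _
  obtain ⟨C, hC1, hCS, hC⟩ := local_compact_nhds hsource
  -- With N·N ⊆ C and `f` supported in `N`, translating `f` by elements of `N` keeps its support
  -- inside `C`.
  obtain ⟨N, hN, hN1, hNN⟩ := exists_open_nhds_one_mul_subset hC1
  have hNC : N ⊆ C := fun g hg => hNN (by simpa using Set.mul_mem_mul hg hN1)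
  have hU : {h | ‖1 - σ h‖ < 1 / 2} ∈ 𝓝 (1 : G) := by
    refine (isOpen_lt (by fun_prop) continuous_const).mem_nhds ?_
    simp
  obtain ⟨f, -, hfN⟩ := (SmoothBumpFunction.nhds_basis_support (I := 𝓡 n)
    (Filter.inter_mem hU (hN.mem_nhds hN1))).mem_iff.1
      (Filter.inter_mem hU (hN.mem_nhds hN1))
  have hfs : ContMDiff (𝓡 n) 𝓘(ℝ, ℝ) ∞ f := f.contMDiff
  have hfsupp : ∀ h, f h ≠ 0 → h ∈ {h | ‖1 - σ h‖ < 1 / 2} ∩ N := fun h hh => hfN hh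
  have hF := contMDiffAt_one_convolution (μ := μ) hfs hC hCS hN hN1 hNC (fun g hg h hh => by
    have h1 := (hfsupp _ hh).2
    have h2 := hNN (Set.mul_mem_mul hg h1)
    rwa [mul_inv_cancel_left] at h2) hσ
  have hint : ∀ k : G → A, Continuous k → Integrable k μ := fun k hk =>
    hk.integrable_of_hasCompactSupport (HasCompactSupport.of_compactSpace _)
  have hi1 : Integrable (fun h => f h • (1 : A)) μ := hint _ (f.continuous.smul continuous_const)
  have hi2 : Integrable (fun h => f h • σ h) μ := hint _ (f.continuous.smul hσ)
  have hfint : Integrable f μ :=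
    f.continuous.integrable_of_hasCompactSupport (HasCompactSupport.of_compactSpace _)
  set m : ℝ := ∫ h, f h ∂μ with hm
  have hm0 : 0 < m := f.continuous.integral_pos_of_hasCompactSupport_nonneg_nonzero (x := 1)
    (HasCompactSupport.of_compactSpace _) (fun g => f.nonneg) (by simp)
  set a : A := ∫ h, f h • σ h ∂μ with ha
  -- On the support of `f` the value σ(h) is within 1/2 of 1, so the normalized average m⁻¹a is too,
  -- and it is invertible by the Neumann series.
  have hau : IsUnit a := by
    have h1 : ‖m • (1 : A) - a‖ ≤ m * (1 / 2) := by
      rw [hm, ha, ← integral_smul_const, ← integral_sub hi1 hi2, ← integral_mul_const]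
      refine norm_integral_le_of_norm_le (hfint.mul_const _)
        (Filter.Eventually.of_forall fun h => ?_)
      rw [← smul_sub, norm_smul, Real.norm_of_nonneg f.nonneg]
      by_cases hh : f h = 0
      · simp [hh]
      · exact mul_le_mul_of_nonneg_left (hfsupp h hh).1.le f.nonneg
    have h2 : ‖(1 : A) - m⁻¹ • a‖ < 1 := by
      have h3 : (1 : A) - m⁻¹ • a = m⁻¹ • (m • (1 : A) - a) := by
        rw [smul_sub, smul_smul, inv_mul_cancel₀ hm0.ne', one_smul]
      rw [h3, norm_smul, norm_inv, Real.norm_of_nonneg hm0.le]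
      calc m⁻¹ * ‖m • (1 : A) - a‖ ≤ m⁻¹ * (m * (1 / 2)) := by gcongr
        _ = 1 / 2 := by field_simp
        _ < 1 := by norm_num
    have h4 := isUnit_one_sub_of_norm_lt_one h2
    rw [sub_sub_cancel] at h4
    have h5 : a = algebraMap ℝ A m * (m⁻¹ • a) := by
      rw [← Algebra.smul_def, smul_smul, mul_inv_cancel₀ hm0.ne', one_smul]
    rw [h5]
    exact (hm0.ne'.isUnit.map (algebraMap ℝ A)).mul h4
  obtain ⟨b, hb⟩ := hau.exists_right_inv
  -- Left invariance turns σ(g)a into the convolution already known to be smooth; multiplying by the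
  -- inverse of `a` recovers σ.
  have hkey : ∀ g, σ g * a = ∫ h, f (g⁻¹ * h) • σ h ∂μ := fun g => by
    rw [← integral_mul_left_eq_self (fun h => f (g⁻¹ * h) • σ h) g, ha,
      ← integral_const_mul_of_integrable hi2]
    congr 1
    funext h
    rw [inv_mul_cancel_left, map_mul, mul_smul_comm]
  have h6 := ((hmul b).contMDiffAt).comp (1 : G) hF
  refine h6.congr_of_eventuallyEq (Filter.Eventually.of_forall fun g => ?_)
  simp [← hkey, mul_assoc, hb]

end Smoothing

/-! ### Smooth structures from compatible local homeomorphisms -/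

section Charts

open Set

variable {F : Type*} [NormedAddCommGroup F] [NormedSpace ℝ F] {HB : Type*} [TopologicalSpace HB]
  {I : ModelWithCorners ℝ F HB} {B : Type*} [TopologicalSpace B] [ChartedSpace HB B]
  {m : ℕ} {M ι : Type*} [TopologicalSpace M]

/-- The chart of a boundaryless manifold at `b`, read in a coordinate space. -/
def coordChart (I : ModelWithCorners ℝ F HB) [I.Boundaryless]
    (L : F ≃L[ℝ] EuclideanSpace ℝ (Fin m)) (b : B) :
    OpenPartialHomeomorph B (EuclideanSpace ℝ (Fin m)) :=
  (chartAt HB b).trans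
    (I.toHomeomorph.toOpenPartialHomeomorph.trans L.toHomeomorph.toOpenPartialHomeomorph)

section

variable [I.Boundaryless] (L : F ≃L[ℝ] EuclideanSpace ℝ (Fin m)) (b : B)

theorem coordChart_source : (coordChart I L b).source = (chartAt HB b).source := by
  simp [coordChart]

theorem mem_coordChart_source : b ∈ (coordChart I L b).source := by
  rw [coordChart_source]
  exact mem_chart_source HB b

theorem coordChart_coe : ⇑(coordChart I L b) = L ∘ extChartAt I b := by
  ext x
  simp [coordChart]

theorem coordChart_symm_coe : ⇑(coordChart I L b).symm = (extChartAt I b).symm ∘ L.symm := by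
  ext x
  simp [coordChart]

variable [IsManifold I ∞ B]

theorem contMDiffOn_coordChart :
    ContMDiffOn I (𝓡 m) ∞ (coordChart I L b) (coordChart I L b).source := by
  rw [coordChart_source, coordChart_coe]
  exact L.contDiff.contMDiff.comp_contMDiffOn contMDiffOn_extChartAt

theorem contMDiffOn_coordChart_symm :
    ContMDiffOn (𝓡 m) I ∞ (coordChart I L b).symm (coordChart I L b).target := by
  rw [coordChart_symm_coe]
  refine (contMDiffOn_extChartAt_symm b).comp L.symm.contDiff.contMDiff.contMDiffOn ?_
  intro x hx
  have h1 : L.symm x = extChartAt I b ((coordChart I L b).symm x) := by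
    have h0 := (coordChart I L b).right_inv hx
    rw [coordChart_coe] at h0
    exact (L.symm_apply_eq).2 h0.symm
  change L.symm x ∈ (extChartAt I b).target
  rw [h1]
  refine (extChartAt I b).map_source ?_
  rw [extChartAt_source, ← coordChart_source (I := I) L b]
  exact (coordChart I L b).map_target hx

/-- Local homeomorphisms to a manifold with smooth transitions define a smooth structure for which
they are local diffeomorphisms. -/
theorem exists_chartedSpace_of_openPartialHomeomorph
    (L : F ≃L[ℝ] EuclideanSpace ℝ (Fin m)) (t : ι → OpenPartialHomeomorph M B)
    (hcover : ∀ x, ∃ i, x ∈ (t i).source)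
    (hcompat : ∀ i j, ContMDiffOn I I ∞ (t j ∘ (t i).symm)
      ((t i).target ∩ (t i).symm ⁻¹' (t j).source)) :
    ∃ _ : ChartedSpace (EuclideanSpace ℝ (Fin m)) M, IsManifold (𝓡 m) ∞ M ∧
      (∀ i, ContMDiffOn (𝓡 m) I ∞ (t i) (t i).source) ∧
      ∀ i, ContMDiffOn I (𝓡 m) ∞ (t i).symm (t i).target := by
  choose k hk using hcover
  -- The atlas follows each `t i` by the coordinate charts at all points of `B`, so a transition map
  -- is a transition of the `t i` read in smooth charts.
  let e (i : ι) (b : B) : OpenPartialHomeomorph M (EuclideanSpace ℝ (Fin m)) :=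
    (t i).trans (coordChart I L b)
  have hes : ∀ i b x, x ∈ (e i b).source ↔
      x ∈ (t i).source ∧ t i x ∈ (coordChart I L b).source := fun i b x => by
    simp [e]
  have het : ∀ i b y, y ∈ (e i b).target ↔ y ∈ (coordChart I L b).target ∧
      (coordChart I L b).symm y ∈ (t i).target := fun i b y => by
    simp [e]
  let cs : ChartedSpace (EuclideanSpace ℝ (Fin m)) M :=
    { atlas := Set.range fun p : ι × B => e p.1 p.2
      chartAt := fun x => e (k x) (t (k x) x)
      mem_chart_source := fun x => (hes _ _ _).2 ⟨hk x, mem_coordChart_source L _⟩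
      chart_mem_atlas := fun x => ⟨(k x, t (k x) x), rfl⟩ }
  have hatlas : ∀ i b, e i b ∈ atlas (EuclideanSpace ℝ (Fin m)) M := fun i b => ⟨(i, b), rfl⟩
  have hmani : IsManifold (𝓡 m) ∞ M := by
    refine isManifold_of_contDiffOn (𝓡 m) ∞ M ?_
    rintro _ _ ⟨⟨i, b⟩, rfl⟩ ⟨⟨j, b'⟩, rfl⟩
    have h1 : ContMDiffOn (𝓡 m) (𝓡 m) ∞
        (coordChart I L b' ∘ (t j ∘ (t i).symm) ∘ (coordChart I L b).symm)
        ((e i b).symm.trans (e j b')).source := by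
      refine (contMDiffOn_coordChart L b').comp ((hcompat i j).comp
        ((contMDiffOn_coordChart_symm L b).mono ?_) ?_) ?_
      all_goals
        intro y hy
        rw [OpenPartialHomeomorph.trans_source, OpenPartialHomeomorph.symm_source, mem_inter_iff,
          het, mem_preimage, hes] at hy
      · exact hy.1.1
      · exact ⟨hy.1.2, hy.2.1⟩
      · exact hy.2.2
    rw [contMDiffOn_iff_contDiffOn] at h1
    simpa using! h1
  refine ⟨cs, hmani, fun i x hx => ?_, fun i y hy => ?_⟩
  · have hxs : x ∈ (e i (t i x)).source := (hes _ _ _).2 ⟨hx, mem_coordChart_source L _⟩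
    have h1 : ContMDiffAt (𝓡 m) (𝓡 m) ∞ (e i (t i x)) x :=
      contMDiffAt_of_mem_maximalAtlas
        (IsManifold.subset_maximalAtlas (hatlas i (t i x))) hxs
    have h2 : ContMDiffAt (𝓡 m) I ∞ (coordChart I L (t i x)).symm (e i (t i x) x) :=
      (contMDiffOn_coordChart_symm L (t i x)).contMDiffAt
        ((coordChart I L (t i x)).open_target.mem_nhds
          ((coordChart I L (t i x)).map_source (mem_coordChart_source L _)))
    refine ((h2.comp x h1).congr_of_eventuallyEq ?_).contMDiffWithinAt
    filter_upwards [(e i (t i x)).open_source.mem_nhds hxs] with x' hx'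
    exact ((coordChart I L (t i x)).left_inv ((hes _ _ _).1 hx').2).symm
  · have hyt : coordChart I L y y ∈ (e i y).target := (het _ _ _).2
      ⟨(coordChart I L y).map_source (mem_coordChart_source L _), by
        rwa [(coordChart I L y).left_inv (mem_coordChart_source L _)]⟩
    have h1 : ContMDiffAt I (𝓡 m) ∞ (coordChart I L y) y :=
      (contMDiffOn_coordChart L y).contMDiffAt
        ((coordChart I L y).open_source.mem_nhds (mem_coordChart_source L _))
    have h2 : ContMDiffAt (𝓡 m) (𝓡 m) ∞ (e i y).symm (coordChart I L y y) :=
      contMDiffAt_symm_of_mem_maximalAtlas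
        (IsManifold.subset_maximalAtlas (hatlas i y)) hyt
    refine ((h2.comp y h1).congr_of_eventuallyEq ?_).contMDiffWithinAt
    filter_upwards [(coordChart I L y).open_source.mem_nhds (mem_coordChart_source L _)]
      with y' hy'
    change (t i).symm y' = (t i).symm ((coordChart I L y).symm (coordChart I L y y'))
    rw [(coordChart I L y).left_inv hy']

end

end Charts

/-! ### The phase map and smoothness into the circle -/

section Phase

variable {F : Type*} [NormedAddCommGroup F] [NormedSpace ℝ F] {HB : Type*} [TopologicalSpace HB]
  {I : ModelWithCorners ℝ F HB} {M : Type*} [TopologicalSpace M] [ChartedSpace HB M]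

attribute [local instance] finrank_real_complex_fact'

theorem contMDiff_circle_coe : ContMDiff (𝓡 1) 𝓘(ℝ, ℂ) ∞ fun z : Circle => (z : ℂ) :=
  contMDiff_coe_sphere (E := ℂ) (n := 1)

/-- A map to the circle is smooth at a point if it is smooth there as a map to `ℂ`. -/
theorem contMDiffAt_circle_of_coe {f : M → Circle} {x : M}
    (hf : ContMDiffAt I 𝓘(ℝ, ℂ) ∞ (fun y => (f y : ℂ)) x) : ContMDiffAt I (𝓡 1) ∞ f x := by
  rw [contMDiffAt_iff_target]
  refine ⟨Topology.IsInducing.subtypeVal.continuousAt_iff.2 hf.continuousAt, ?_⟩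
  let v : Metric.sphere (0 : ℂ) 1 := f x
  let U : _ ≃ₗᵢ[ℝ] EuclideanSpace ℝ (Fin 1) :=
    (OrthonormalBasis.fromOrthogonalSpanSingleton (𝕜 := ℝ) 1
      (ne_zero_of_mem_unit_sphere (-v))).repr
  -- The circle's chart at f x is stereographic projection from the antipode, which extends smoothly
  -- to a neighbourhood of f x in ℂ.
  have h1 : ContDiffAt ℝ ∞ (U ∘ stereoToFun (-v : ℂ)) (f x : ℂ) := by
    refine U.contDiff.contDiffAt.comp _ (((contDiffOn_stereoToFun (n := ω)).of_le
      le_top).contDiffAt ?_)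
    refine (isOpen_ne_fun (by fun_prop) (by fun_prop)).mem_nhds ?_
    change innerSL ℝ (-v : ℂ) (v : ℂ) ≠ 1
    have hv : ‖(v : ℂ)‖ = 1 := norm_eq_of_mem_sphere v
    have h2 : inner ℝ (v : ℂ) (v : ℂ) = 1 := by
      rw [real_inner_self_eq_norm_sq, hv, one_pow]
    rw [innerSL_apply_apply, inner_neg_left, h2]
    norm_num
  have h2 := h1.contMDiffAt.comp x hf
  exact h2

/-- The phase of a complex number. -/
def phase (w : ℂ) : Circle := Circle.exp w.arg

theorem norm_mul_phase (w : ℂ) : (‖w‖ : ℂ) * phase w = w := by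
  rw [phase, Circle.coe_exp]
  exact Complex.norm_mul_exp_arg_mul_I w

/-- Away from 0 the phase is w/|w|, a smooth expression. At 0 it has the default value 1, since the
argument of 0 is 0; hence the nonvanishing hypotheses below. -/
theorem coe_phase {w : ℂ} (hw : w ≠ 0) : (phase w : ℂ) = ((‖w‖⁻¹ : ℝ) : ℂ) * w := by
  have h : (‖w‖ : ℂ) ≠ 0 := by simpa using hw
  conv_rhs => rw [← norm_mul_phase w]
  rw [norm_mul, Complex.norm_real, norm_norm, Circle.norm_coe, mul_one]
  push_cast
  field_simp

theorem phase_mul {w w' : ℂ} (hw : w ≠ 0) (hw' : w' ≠ 0) : phase (w * w') = phase w * phase w' := by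
  refine Circle.ext ?_
  rw [Circle.coe_mul, coe_phase hw, coe_phase hw', coe_phase (mul_ne_zero hw hw'), norm_mul,
    mul_inv]
  push_cast
  ring

theorem phase_circle (z : Circle) : phase z = z := by
  refine Circle.ext ?_
  rw [coe_phase (Circle.coe_ne_zero z), Circle.norm_coe]
  simp

theorem phase_conj {w : ℂ} (hw : w ≠ 0) : phase (starRingEnd ℂ w) = (phase w)⁻¹ := by
  refine Circle.ext ?_
  rw [Circle.coe_inv_eq_conj, coe_phase hw, coe_phase (by simpa using hw), map_mul,
    Complex.conj_ofReal, Complex.norm_conj]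

theorem contMDiffAt_phase {w : ℂ} (hw : w ≠ 0) : ContMDiffAt 𝓘(ℝ, ℂ) (𝓡 1) ∞ phase w := by
  refine contMDiffAt_circle_of_coe (ContDiffAt.contMDiffAt ?_)
  have h1 : ContDiffAt ℝ ∞ (fun w : ℂ => ((‖w‖⁻¹ : ℝ) : ℂ) * w) w :=
    (Complex.ofRealCLM.contDiff.contDiffAt.comp w ((contDiffAt_norm ℝ hw).inv
      (norm_ne_zero_iff.2 hw))).mul contDiffAt_id
  refine h1.congr_of_eventuallyEq ?_
  filter_upwards [isOpen_ne.mem_nhds hw] with w' hw'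
  exact coe_phase hw'

theorem continuousAt_phase {w : ℂ} (hw : w ≠ 0) : ContinuousAt phase w :=
  (contMDiffAt_phase hw).continuousAt

end Phase

/-! ### Local trivializations from weight-one functions -/

section CircleBundle

open Set

variable {n : ℕ} {G : Type u} [Group G] [TopologicalSpace G]
  [ChartedSpace (EuclideanSpace ℝ (Fin n)) G]

/-- Functions on the total group of weight one for the circle action whose products
`r i * conj (r j)` descend to smooth functions `q i j` on `G`. -/
structure WeightFrame (n : ℕ) {G : Type u} [Group G] [TopologicalSpace G]
    [ChartedSpace (EuclideanSpace ℝ (Fin n)) G] (X : CircleExtension.{u, w} G) (ι : Type*) where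
  r : ι → X.E → ℂ
  q : ι → ι → G → ℂ
  continuous_r : ∀ i, Continuous (r i)
  r_inl_mul : ∀ i z e, r i (X.ext.inl z * e) = z * r i e
  exists_ne_zero : ∀ e, ∃ i, r i e ≠ 0
  r_mul_conj : ∀ i j e, r i e * starRingEnd ℂ (r j e) = q i j (X.ext.rightHom e)
  contMDiff_q : ∀ i j, ContMDiff (𝓡 n) 𝓘(ℝ, ℂ) ∞ (q i j)

namespace WeightFrame

variable {X : CircleExtension.{u, w} G} {ι : Type*} (R : WeightFrame n X ι)

/-- A set-theoretic section of the projection. -/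
def sec (X : CircleExtension.{u, w} G) (g : G) : X.E :=
  Function.surjInv X.ext.rightHom_surjective g

theorem rightHom_sec (X : CircleExtension.{u, w} G) (g : G) : X.ext.rightHom (sec X g) = g :=
  Function.surjInv_eq X.ext.rightHom_surjective g

theorem q_self (i : ι) (e : X.E) :
    R.q i i (X.ext.rightHom e) = ((‖R.r i e‖ ^ 2 : ℝ) : ℂ) := by
  rw [← R.r_mul_conj, Complex.mul_conj, Complex.normSq_eq_norm_sq]

theorem q_self_ne_zero_iff (i : ι) (e : X.E) :
    R.q i i (X.ext.rightHom e) ≠ 0 ↔ R.r i e ≠ 0 := by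
  rw [R.q_self]
  simp

theorem r_sec_ne_zero_iff (i : ι) (g : G) : R.r i (sec X g) ≠ 0 ↔ R.q i i g ≠ 0 := by
  rw [← R.q_self_ne_zero_iff, rightHom_sec]

/-- The local trivialization over the set where `r i` does not vanish, as a partial equivalence. -/
def trivEquiv (i : ι) : PartialEquiv X.E (G × Circle) where
  toFun e := (X.ext.rightHom e, phase (R.r i e))
  invFun b := X.ext.inl (b.2 * (phase (R.r i (sec X b.1)))⁻¹) * sec X b.1
  source := {e | R.r i e ≠ 0}
  target := {b | R.q i i b.1 ≠ 0}
  map_source' e he := (R.q_self_ne_zero_iff i e).2 he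
  map_target' b hb := by
    change R.r i _ ≠ 0
    rw [R.r_inl_mul]
    exact mul_ne_zero (Circle.coe_ne_zero _) ((R.r_sec_ne_zero_iff i b.1).2 hb)
  left_inv' e he := by
    obtain ⟨z, hz⟩ := X.exists_inl_of_rightHom_eq (rightHom_sec X (X.ext.rightHom e)).symm
    have h1 : R.r i e = z * R.r i (sec X (X.ext.rightHom e)) := by
      conv_lhs => rw [hz]
      exact R.r_inl_mul i z _
    have h2 : R.r i (sec X (X.ext.rightHom e)) ≠ 0 := fun h0 => he (by rw [h1, h0, mul_zero])
    change X.ext.inl (phase (R.r i e) * (phase (R.r i (sec X (X.ext.rightHom e))))⁻¹) *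
      sec X (X.ext.rightHom e) = e
    rw [h1, phase_mul (Circle.coe_ne_zero z) h2, phase_circle, mul_inv_cancel_right, ← hz]
  right_inv' b hb := by
    have h2 := (R.r_sec_ne_zero_iff i b.1).2 hb
    refine Prod.ext ?_ ?_
    · change X.ext.rightHom (X.ext.inl _ * sec X b.1) = b.1
      rw [map_mul, X.rightHom_inl, one_mul, rightHom_sec]
    · change phase (R.r i (X.ext.inl _ * sec X b.1)) = b.2
      rw [R.r_inl_mul, phase_mul (Circle.coe_ne_zero _) h2, phase_circle, inv_mul_cancel_right]

theorem continuousOn_phase_r (i : ι) :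
    ContinuousOn (fun e => phase (R.r i e)) {e | R.r i e ≠ 0} := fun _ he =>
  ((continuousAt_phase he).comp (R.continuous_r i).continuousAt).continuousWithinAt

theorem isOpen_source (i : ι) : IsOpen {e | R.r i e ≠ 0} :=
  isOpen_ne_fun (R.continuous_r i) continuous_const

theorem isOpen_target (i : ι) : IsOpen {b : G × Circle | R.q i i b.1 ≠ 0} :=
  isOpen_ne_fun ((R.contMDiff_q i i).continuous.comp continuous_fst) continuous_const

/-- The local trivialization over the set where `r i` does not vanish. -/
def triv (i : ι) : OpenPartialHomeomorph X.E (G × Circle) where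
  toPartialEquiv := R.trivEquiv i
  open_source := R.isOpen_source i
  open_target := R.isOpen_target i
  continuousOn_toFun :=
    X.continuous_rightHom.continuousOn.prodMk (R.continuousOn_phase_r i)
  continuousOn_invFun := by
    refine (continuousOn_open_iff (R.isOpen_target i)).2 fun W hW => ?_
    -- The section is not continuous, so the inverse is lifted to X.E × S¹, where it has the
    -- continuous formula `a`. Openness of preimages descends along the open map p × id.
    let a : X.E × Circle → X.E := fun p => X.ext.inl (p.2 * (phase (R.r i p.1))⁻¹) * p.1
    have ha : ContinuousOn a {p | R.r i p.1 ≠ 0} := by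
      have h1 : ContinuousOn (fun p : X.E × Circle => phase (R.r i p.1)) {p | R.r i p.1 ≠ 0} :=
        (R.continuousOn_phase_r i).comp continuous_fst.continuousOn fun p hp => hp
      exact (X.continuous_inl.comp_continuousOn
        (continuous_snd.continuousOn.mul h1.inv)).mul continuous_fst.continuousOn
    have hopen : IsOpen ({p : X.E × Circle | R.r i p.1 ≠ 0} ∩ a ⁻¹' W) :=
      ha.isOpen_inter_preimage ((R.isOpen_source i).preimage continuous_fst) hW
    have hmap : IsOpenMap (Prod.map X.ext.rightHom (id : Circle → Circle)) :=
      X.isSES.isOpenQuotientMap.isOpenMap.prodMap IsOpenMap.id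
    convert! hmap _ hopen using 1
    have hinv : ∀ e z, R.r i e ≠ 0 → (R.trivEquiv i).symm (X.ext.rightHom e, z) = a (e, z) := by
      intro e z he
      have h1 : a (e, z) ∈ (R.trivEquiv i).source := by
        change R.r i (X.ext.inl _ * e) ≠ 0
        rw [R.r_inl_mul]
        exact mul_ne_zero (Circle.coe_ne_zero _) he
      rw [← (R.trivEquiv i).left_inv h1]
      congr 1
      refine Prod.ext ?_ ?_
      · change _ = X.ext.rightHom (X.ext.inl _ * e)
        rw [map_mul, X.rightHom_inl, one_mul]
      · change z = phase (R.r i (X.ext.inl _ * e))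
        rw [R.r_inl_mul, phase_mul (Circle.coe_ne_zero _) he, phase_circle, inv_mul_cancel_right]
    ext ⟨g, z⟩
    constructor
    · rintro ⟨hg, hgW⟩
      have h1 := (R.r_sec_ne_zero_iff i g).2 hg
      refine ⟨(sec X g, z), ⟨h1, ?_⟩, Prod.ext (rightHom_sec X g) rfl⟩
      have h2 := hinv _ z h1
      rw [rightHom_sec] at h2
      rw [mem_preimage, ← h2]
      exact hgW
    · rintro ⟨⟨e, z'⟩, ⟨he, heW⟩, heq⟩
      obtain ⟨rfl, rfl⟩ := Prod.mk.inj heq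
      refine ⟨(R.q_self_ne_zero_iff i e).2 he, ?_⟩
      change (R.trivEquiv i).symm (X.ext.rightHom e, z') ∈ W
      rw [hinv e z' he]
      exact heW

/-- The transition functions are multiplications by the phases of the functions `q`. -/
theorem triv_eq_of_ne_zero (i j : ι) {e : X.E} (hi : R.r i e ≠ 0) (hj : R.r j e ≠ 0) :
    R.triv j e = ((R.triv i e).1, (R.triv i e).2 * phase (R.q j i (R.triv i e).1)) := by
  refine Prod.ext rfl ?_
  change phase (R.r j e) = phase (R.r i e) * phase (R.q j i (X.ext.rightHom e))
  rw [← R.r_mul_conj, phase_mul hj (by simpa using hi), phase_conj hi, mul_comm, mul_assoc,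
    inv_mul_cancel, mul_one]

/-- The transition is (g, z) ↦ (g, z · phase(q j i g)), and q j i does not vanish on the overlap,
where the phase is smooth. -/
theorem contMDiffOn_triv_symm_triv (i j : ι) :
    ContMDiffOn ((𝓡 n).prod (𝓡 1)) ((𝓡 n).prod (𝓡 1)) ∞ (R.triv j ∘ (R.triv i).symm)
      ((R.triv i).target ∩ (R.triv i).symm ⁻¹' (R.triv j).source) := by
  intro b hb
  have hmem : (R.triv i).target ∩ (R.triv i).symm ⁻¹' (R.triv j).source ∈ 𝓝 b :=
    ((R.triv i).symm.isOpen_inter_preimage (R.triv j).open_source).mem_nhds hb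
  have heq : ∀ b ∈ (R.triv i).target ∩ (R.triv i).symm ⁻¹' (R.triv j).source,
      (R.triv j ∘ (R.triv i).symm) b = (b.1, b.2 * phase (R.q j i b.1)) := by
    intro b hb
    have h1 := R.triv_eq_of_ne_zero i j ((R.triv i).map_target hb.1) hb.2
    rw [(R.triv i).right_inv hb.1] at h1
    exact h1
  have hq : R.q j i b.1 ≠ 0 := by
    have h1 : X.ext.rightHom ((R.triv i).symm b) = b.1 :=
      congrArg Prod.fst ((R.triv i).right_inv hb.1)
    rw [← h1, ← R.r_mul_conj]
    have h2 : R.r i ((R.triv i).symm b) ≠ 0 := (R.triv i).map_target hb.1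
    exact mul_ne_zero hb.2 (by simpa using h2)
  have h1 : ContMDiffAt ((𝓡 n).prod (𝓡 1)) (𝓡 1) ∞
      (fun b : G × Circle => phase (R.q j i b.1)) b :=
    ContMDiffAt.comp b (g := phase) (contMDiffAt_phase hq)
      (((R.contMDiff_q j i).contMDiffAt (x := b.1)).comp b contMDiffAt_fst)
  have hLie : LieGroup (𝓡 1) ∞ Circle := LieGroup.of_le (n := ω) le_top
  have h2 : ContMDiffAt ((𝓡 n).prod (𝓡 1)) ((𝓡 n).prod (𝓡 1)) ∞
      (fun b : G × Circle => (b.1, b.2 * phase (R.q j i b.1))) b :=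
    contMDiffAt_fst.prodMk (contMDiffAt_snd.mul h1)
  exact (h2.congr_of_eventuallyEq (Filter.mem_of_superset hmem heq)).contMDiffWithinAt

section Manifold

variable {m : ℕ} [ChartedSpace (EuclideanSpace ℝ (Fin m)) X.E]

/-- The functions `r` are smooth for a smooth structure in which the trivializations are smooth. -/
theorem contMDiff_r (ht : ∀ i, ContMDiffOn (𝓡 m) ((𝓡 n).prod (𝓡 1)) ∞ (R.triv i)
    (R.triv i).source) (j : ι) : ContMDiff (𝓡 m) 𝓘(ℝ, ℂ) ∞ (R.r j) := by
  intro e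
  obtain ⟨i, hi⟩ := R.exists_ne_zero e
  have hnhds := (R.isOpen_source i).mem_nhds hi
  have h1 : ContMDiffAt (𝓡 m) ((𝓡 n).prod (𝓡 1)) ∞ (R.triv i) e :=
    (ht i).contMDiffAt hnhds
  have hp : ContMDiffAt (𝓡 m) (𝓡 n) ∞ (fun e => X.ext.rightHom e) e :=
    contMDiffAt_fst.comp e h1
  have hz : ContMDiffAt (𝓡 m) 𝓘(ℝ, ℂ) ∞ (fun e => (phase (R.r i e) : ℂ)) e :=
    (contMDiff_circle_coe.contMDiffAt).comp e (contMDiffAt_snd.comp e h1)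
  have hqj : ContMDiffAt (𝓡 m) 𝓘(ℝ, ℂ) ∞ (fun e => R.q j i (X.ext.rightHom e)) e :=
    (R.contMDiff_q j i).contMDiffAt.comp e hp
  have hqi : ContMDiffAt (𝓡 m) 𝓘(ℝ, ℂ) ∞ (fun e => R.q i i (X.ext.rightHom e)) e :=
    (R.contMDiff_q i i).contMDiffAt.comp e hp
  have hpos : 0 < (R.q i i (X.ext.rightHom e)).re := by
    rw [R.q_self, Complex.ofReal_re]
    positivity
  -- Where r i ≠ 0, r j is the product of q j i and the phase of r i, divided by √(q i i) = |r i|;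
  -- each ingredient is smooth in the trivialization.
  have hΨ : ContDiffAt ℝ ∞ (fun c : ℂ × ℂ × ℂ => c.1 * c.2.1 * ((√c.2.2.re)⁻¹ : ℝ))
      (R.q j i (X.ext.rightHom e), (phase (R.r i e) : ℂ), R.q i i (X.ext.rightHom e)) := by
    refine (contDiffAt_fst.mul (contDiffAt_fst.comp _ contDiffAt_snd)).mul
      (Complex.ofRealCLM.contDiff.contDiffAt.comp _ ?_)
    refine ContDiffAt.inv (ContDiffAt.sqrt ?_ hpos.ne') (Real.sqrt_pos.2 hpos).ne'
    exact Complex.reCLM.contDiff.contDiffAt.comp _ (contDiffAt_snd.comp _ contDiffAt_snd)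
  have h2 := hΨ.contMDiffAt.comp e (hqj.prodMk_space (hz.prodMk_space hqi))
  refine h2.congr_of_eventuallyEq ?_
  filter_upwards [hnhds] with e' he'
  have hne : R.r i e' ≠ 0 := he'
  have hn : (‖R.r i e'‖ : ℂ) ≠ 0 := by simpa using hne
  simp only [Function.comp_apply]
  rw [R.q_self, Complex.ofReal_re, Real.sqrt_sq (norm_nonneg _), coe_phase hne, ← R.r_mul_conj]
  have h3 : starRingEnd ℂ (R.r i e') * R.r i e' = (‖R.r i e'‖ : ℂ) ^ 2 := Complex.conj_mul' _
  push_cast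
  field_simp
  linear_combination (-R.r j e') * h3

theorem contMDiff_rightHom (ht : ∀ i, ContMDiffOn (𝓡 m) ((𝓡 n).prod (𝓡 1)) ∞ (R.triv i)
    (R.triv i).source) : ContMDiff (𝓡 m) (𝓡 n) ∞ X.ext.rightHom := by
  intro e
  obtain ⟨i, hi⟩ := R.exists_ne_zero e
  exact contMDiffAt_fst.comp e ((ht i).contMDiffAt ((R.isOpen_source i).mem_nhds hi))

/-- A map to the total group is smooth if its compositions with the projection and with the
functions `r` are. -/
theorem contMDiff_of_comp (ht : ∀ i, ContMDiffOn ((𝓡 n).prod (𝓡 1)) (𝓡 m) ∞ (R.triv i).symm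
    (R.triv i).target) {F : Type*} [NormedAddCommGroup F] [NormedSpace ℝ F] {HM : Type*}
    [TopologicalSpace HM] {I : ModelWithCorners ℝ F HM} {M : Type*} [TopologicalSpace M]
    [ChartedSpace HM M] {f : M → X.E} (hp : ContMDiff I (𝓡 n) ∞ fun x => X.ext.rightHom (f x))
    (hr : ∀ i, ContMDiff I 𝓘(ℝ, ℂ) ∞ fun x => R.r i (f x)) : ContMDiff I (𝓡 m) ∞ f := by
  intro x
  obtain ⟨i, hi⟩ := R.exists_ne_zero (f x)
  have h1 : ContMDiffAt I ((𝓡 n).prod (𝓡 1)) ∞ (fun x => R.triv i (f x)) x :=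
    (hp x).prodMk (ContMDiffAt.comp x (g := phase) (contMDiffAt_phase hi) (hr i x))
  have h2 : ContMDiffAt ((𝓡 n).prod (𝓡 1)) (𝓡 m) ∞ (R.triv i).symm (R.triv i (f x)) :=
    (ht i).contMDiffAt ((R.triv i).open_target.mem_nhds ((R.triv i).map_source hi))
  refine (h2.comp x h1).congr_of_eventuallyEq ?_
  filter_upwards [(isOpen_ne_fun (hr i).continuous continuous_const).mem_nhds hi] with y hy
  exact ((R.triv i).left_inv hy).symm

end Manifold

end WeightFrame

end CircleBundle

/-! ### Matrix coefficients and the Lie group structure -/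

section MatrixCoefficients

variable {n : ℕ} {G : Type u} [Group G] [TopologicalSpace G]
  [ChartedSpace (EuclideanSpace ℝ (Fin n)) G]

/-- The matrix coefficients of a finite-dimensional unitary representation. -/
def coeff {E : Type w} [Group E] [TopologicalSpace E] (V : Irrep E) (i j : Fin V.dim) (e : E) : ℂ :=
  inner ℂ (EuclideanSpace.basisFun (Fin V.dim) ℂ i)
    (V.hom e (EuclideanSpace.basisFun (Fin V.dim) ℂ j))

theorem coeff_mul {E : Type w} [Group E] [TopologicalSpace E] (V : Irrep E) (i j : Fin V.dim)
    (e e' : E) : coeff V i j (e * e') = ∑ k, coeff V i k e * coeff V k j e' := by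
  simp only [coeff, map_mul, UH.mul_apply]
  rw [← inner_conj_symm, UH.inner_apply_left, inner_conj_symm,
    ← OrthonormalBasis.sum_inner_mul_inner (EuclideanSpace.basisFun (Fin V.dim) ℂ)]
  refine Finset.sum_congr rfl fun k _ => ?_
  congr 1
  rw [UH.inner_apply_left, inv_inv]

theorem coeff_inv {E : Type w} [Group E] [TopologicalSpace E] (V : Irrep E) (i j : Fin V.dim)
    (e : E) : coeff V i j e⁻¹ = starRingEnd ℂ (coeff V j i e) := by
  simp only [coeff, map_inv]
  rw [inner_conj_symm, UH.inner_apply_left]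

theorem continuous_coeff {E : Type w} [Group E] [TopologicalSpace E] (V : Irrep E)
    (i j : Fin V.dim) : Continuous (coeff V i j) :=
  continuous_const.inner (continuous_apply_hom V.hom _)

/-- If all coefficients vanished at `e`, the invertible operator of `e` would be zero on a nonzero
space. -/
theorem coeff_exists_ne_zero {E : Type w} [Group E] [TopologicalSpace E] (V : Irrep E) (e : E) :
    ∃ p : Fin V.dim × Fin V.dim, coeff V p.1 p.2 e ≠ 0 := by
  by_contra! h
  obtain ⟨x, hx⟩ := V.exists_ne_zero
  have h1 : ∀ j, V.hom e (EuclideanSpace.basisFun (Fin V.dim) ℂ j) = 0 := fun j =>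
    (EuclideanSpace.basisFun (Fin V.dim) ℂ).repr.injective <| by
      ext i
      rw [map_zero, OrthonormalBasis.repr_apply_apply]
      exact h (i, j)
  have h2 : ∀ j, EuclideanSpace.basisFun (Fin V.dim) ℂ j = 0 := fun j =>
    (V.hom e).injective ((h1 j).trans (map_zero _).symm)
  obtain ⟨j, -⟩ : ∃ j, x j ≠ 0 := by
    by_contra! h3
    exact hx (by ext j; exact h3 j)
  exact (EuclideanSpace.basisFun (Fin V.dim) ℂ).orthonormal.ne_zero j (h2 j)

theorem coeff_inl_mul {X : CircleExtension.{u, w} G} {V : Irrep X.E} (hV : V ∈ scalarIrreps X)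
    (i j : Fin V.dim) (z : Circle) (e : X.E) :
    coeff V i j (X.ext.inl z * e) = z * coeff V i j e := by
  simp only [coeff, map_mul, UH.mul_apply]
  rw [hV z, scalar_apply, inner_smul_right]

theorem coeff_inl {X : CircleExtension.{u, w} G} {V : Irrep X.E} (hV : V ∈ scalarIrreps X)
    (i j : Fin V.dim) (z : Circle) :
    coeff V i j (X.ext.inl z) = z * coeff V i j 1 := by
  rw [← coeff_inl_mul hV, mul_one]

/-- A continuous multiplicative map from a circle extension to a Banach algebra which is trivial
on the circle descends to a smooth map on the quotient group. -/
theorem exists_contMDiff_of_monoidHom [LieGroup (𝓡 n) ∞ G] [IsTopologicalGroup G] [T2Space G]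
    [CompactSpace G] (X : CircleExtension.{u, w} G) {A : Type*} [NormedRing A] [NormedAlgebra ℝ A]
    [CompleteSpace A] (τ : X.E →* A) (hτc : Continuous τ) (hτ : ∀ z, τ (X.ext.inl z) = 1) :
    ∃ σ : G → A, ContMDiff (𝓡 n) 𝓘(ℝ, A) ∞ σ ∧ ∀ e, σ (X.ext.rightHom e) = τ e := by
  have hker : ∀ e e', X.ext.rightHom e = X.ext.rightHom e' → τ e = τ e' := fun e e' h => by
    obtain ⟨z, rfl⟩ := X.exists_inl_of_rightHom_eq h
    rw [map_mul, hτ, one_mul]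
  let s (g : G) : X.E := WeightFrame.sec X g
  have hs : ∀ g, X.ext.rightHom (s g) = g := WeightFrame.rightHom_sec X
  let σ : G →* A :=
    { toFun := fun g => τ (s g)
      map_one' := by rw [hker (s 1) 1 (by rw [hs, map_one]), map_one]
      map_mul' := fun g g' => by
        rw [← map_mul]
        exact hker _ _ (by rw [map_mul, hs, hs, hs]) }
  have hσ : ∀ e, σ (X.ext.rightHom e) = τ e := fun e => hker _ _ (hs _)
  have hσc : Continuous σ := by
    refine X.isSES.isOpenQuotientMap.isQuotientMap.continuous_iff.2 ?_
    exact hτc.congr fun e => (hσ e).symm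
  exact ⟨σ, contMDiff_of_continuous_monoidHom (n := n) σ hσc, hσ⟩

/-- The endomorphisms of the space of an irreducible representation. -/
abbrev Irrep.End {E : Type w} [Group E] [TopologicalSpace E] (V : Irrep E) : Type :=
  EuclideanSpace ℂ (Fin V.dim) →L[ℂ] EuclideanSpace ℂ (Fin V.dim)

/-- The products of a matrix coefficient with the conjugate of another one are smooth functions
on the quotient group, being matrix coefficients of the conjugation representation. -/
theorem exists_smooth_coeff_mul_conj [LieGroup (𝓡 n) ∞ G] [IsTopologicalGroup G] [T2Space G]
    [CompactSpace G] {X : CircleExtension.{u, w} G} {V : Irrep X.E} (hV : V ∈ scalarIrreps X)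
    (i j k l : Fin V.dim) : ∃ q : G → ℂ, ContMDiff (𝓡 n) 𝓘(ℝ, ℂ) ∞ q ∧
      ∀ e, coeff V i j e * starRingEnd ℂ (coeff V k l e) = q (X.ext.rightHom e) := by
  let b := EuclideanSpace.basisFun (Fin V.dim) ℂ
  let M (e : X.E) : Irrep.End V := (V.hom e).toContinuousLinearEquiv.toContinuousLinearMap
  have hMc : Continuous M := continuous_clm_apply.2 fun x => continuous_apply_hom V.hom x
  -- In conjugation on End V the scalar from the circle cancels against its inverse, so this
  -- representation descends to G.
  let c (e : X.E) : (Irrep.End V) →L[ℂ] (Irrep.End V) :=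
    LinearMap.toContinuousLinearMap
      { toFun := fun B => M e ∘L B ∘L M e⁻¹
        map_add' := fun B B' => by ext x; simp
        map_smul' := fun a B => by ext x; simp }
  have hc : ∀ e B x, c e B x = V.hom e (B (V.hom e⁻¹ x)) := fun e B x => rfl
  have hcc : Continuous c := continuous_clm_apply.2 fun B =>
    hMc.clm_comp (continuous_const.clm_comp (hMc.comp continuous_inv))
  let τ : X.E →* ((Irrep.End V) →L[ℂ] (Irrep.End V)) :=
    { toFun := c
      map_one' := by
        ext1 B
        ext1 x
        rw [hc, inv_one, map_one V.hom]
        rfl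
      map_mul' := fun e e' => by
        ext1 B
        ext1 x
        change _ = c e (c e' B) x
        rw [hc, hc, hc, mul_inv_rev, map_mul V.hom, map_mul V.hom]
        rfl }
  have hτ : ∀ z, τ (X.ext.inl z) = 1 := fun z => by
    ext1 B
    ext1 x
    change c (X.ext.inl z) B x = B x
    rw [hc, ← map_inv, hV, hV, scalar_apply, scalar_apply, map_smul, smul_smul]
    simp
  obtain ⟨σ, hsm, hσ⟩ := exists_contMDiff_of_monoidHom (n := n) X (A := V.End →L[ℂ] V.End) τ hcc hτ
  -- For B = ⟨b l, ·⟩ b j, the (i, k) entry of the conjugate of B is ⟨b l, V(e)⁻¹ b k⟩ ⟨b i, V(e) b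
  -- j⟩, the required product.
  let B : Irrep.End V := (innerSL ℂ (b l)).smulRight (b j)
  let ℓ : (Irrep.End V →L[ℂ] Irrep.End V) →L[ℂ] ℂ :=
    innerSL ℂ (b i) ∘L ContinuousLinearMap.apply ℂ (EuclideanSpace ℂ (Fin V.dim)) (b k) ∘L ContinuousLinearMap.apply ℂ (Irrep.End V) B
  refine ⟨fun g => ℓ (σ g), (ℓ.restrictScalars ℝ).contDiff.contMDiff.comp hsm, fun e => ?_⟩
  have h1 : ℓ (σ (X.ext.rightHom e)) = inner ℂ (b i) (c e B (b k)) := by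
    rw [hσ]
    rfl
  refine Eq.trans ?_ h1.symm
  rw [hc]
  have h2 : B (V.hom e⁻¹ (b k)) = inner ℂ (b l) (V.hom e⁻¹ (b k)) • b j := rfl
  rw [h2, map_smul, inner_smul_right, mul_comm]
  congr 1
  simp only [coeff]
  rw [inner_conj_symm, map_inv, UH.inner_apply_left]

/-- The weight frame of matrix coefficients. -/
theorem exists_weightFrame [LieGroup (𝓡 n) ∞ G] [IsTopologicalGroup G] [T2Space G]
    [CompactSpace G] {X : CircleExtension.{u, w} G} {V : Irrep X.E} (hV : V ∈ scalarIrreps X) :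
    ∃ R : WeightFrame n X (Fin V.dim × Fin V.dim), ∀ p, R.r p = coeff V p.1 p.2 := by
  choose q hq hq' using fun p p' : Fin V.dim × Fin V.dim =>
    exists_smooth_coeff_mul_conj (n := n) hV p.1 p.2 p'.1 p'.2
  exact ⟨{
    r := fun p => coeff V p.1 p.2
    q := q
    continuous_r := fun p => continuous_coeff V _ _
    r_inl_mul := fun p z e => coeff_inl_mul hV _ _ z e
    exists_ne_zero := coeff_exists_ne_zero V
    r_mul_conj := fun p p' e => hq' p p' e
    contMDiff_q := hq }, fun _ => rfl⟩

/-- An extension of a compact Lie group by the circle with a finite-dimensional representation in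
which the circle acts by scalars is an extension of Lie groups. -/
theorem CircleExtension.isLie_of_scalarIrrep [LieGroup (𝓡 n) ∞ G] [IsTopologicalGroup G]
    [T2Space G] [CompactSpace G] {X : CircleExtension.{u, w} G} {V : Irrep X.E}
    (hV : V ∈ scalarIrreps X) : X.IsLie n := by
  obtain ⟨R, hR⟩ := exists_weightFrame (n := n) hV
  have hmani' : IsManifold (𝓡 1) ∞ Circle := IsManifold.of_le (n := ω) le_top
  have hLie : LieGroup (𝓡 1) ∞ Circle := LieGroup.of_le (n := ω) le_top
  -- The total group has dimension n + 1, from the base and the circle fibre.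
  let L : (EuclideanSpace ℝ (Fin n) × EuclideanSpace ℝ (Fin 1)) ≃L[ℝ]
      EuclideanSpace ℝ (Fin (n + 1)) :=
    ContinuousLinearEquiv.ofFinrankEq (by simp)
  obtain ⟨cs, hE, ht, ht'⟩ := exists_chartedSpace_of_openPartialHomeomorph
    (I := (𝓡 n).prod (𝓡 1)) L R.triv R.exists_ne_zero R.contMDiffOn_triv_symm_triv
  have hp : ContMDiff (𝓡 (n + 1)) (𝓡 n) ∞ X.ext.rightHom := R.contMDiff_rightHom ht
  have hr : ∀ i j, ContMDiff (𝓡 (n + 1)) 𝓘(ℝ, ℂ) ∞ (coeff V i j) := fun i j => by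
    rw [← hR (i, j)]
    exact R.contMDiff_r ht (i, j)
  refine ⟨n + 1, cs, ?_, ?_, hp⟩
  · exact
    { hE with
      contMDiff_mul := by
        refine R.contMDiff_of_comp ht' ?_ fun p => ?_
        · simp only [map_mul]
          exact (hp.comp contMDiff_fst).mul (hp.comp contMDiff_snd)
        · simp only [hR, coeff_mul]
          refine contMDiff_finsetSum fun k _ => ?_
          exact contDiff_mul.contMDiff.comp
            (((hr _ _).comp contMDiff_fst).prodMk_space ((hr _ _).comp contMDiff_snd))
      contMDiff_inv := by
        refine R.contMDiff_of_comp ht' ?_ fun p => ?_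
        · simp only [map_inv]
          exact hp.inv
        · simp only [hR, coeff_inv]
          exact Complex.conjCLE.contDiff.contMDiff.comp (hr _ _) }
  · refine R.contMDiff_of_comp ht' ?_ fun p => ?_
    · simp only [X.rightHom_inl]
      exact contMDiff_const
    · simp only [hR, coeff_inl hV]
      exact (contDiff_id.mul contDiff_const).contMDiff.comp contMDiff_circle_coe

end MatrixCoefficients

/-! ### The Lie structure on pullbacks and the bijection -/

section Main

variable {G : Type u} [Group G] [TopologicalSpace G] {H : Type v} [NormedAddCommGroup H]
  [InnerProductSpace ℂ H]

/-- Any irreducible subrepresentation of ρ inherits its scalar circle action, and compactness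
provides one. -/
theorem CircleExtension.exists_scalarIrrep [CompactSpace G] [CompleteSpace H] [Nontrivial H]
    (X : CircleExtension.{u, w} G) (ρ : X.E →ₜ* UH H)
    (hρ : ∀ z, ρ (X.ext.inl z) = scalar H z) : ∃ V : Irrep X.E, V ∈ scalarIrreps X := by
  obtain ⟨W, -, hW0, hWf, hWinv⟩ := exists_finiteDimensional_invariant ρ ⊤ isClosed_univ
    (fun _ _ _ => Submodule.mem_top) top_ne_bot
  obtain ⟨V, f, -⟩ := exists_irrep_of_invariant ρ W hW0 hWinv
  refine ⟨V, fun z => LinearIsometryEquiv.ext fun x => f.1.injective ?_⟩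
  rw [f.2, hρ, scalar_apply, scalar_apply, map_smul]

theorem isLie_pullbackExtension {n : ℕ} [ChartedSpace (EuclideanSpace ℝ (Fin n)) G]
    [LieGroup (𝓡 n) ∞ G] [IsTopologicalGroup G] [T2Space G] [CompactSpace G] [CompleteSpace H]
    [Nontrivial H] (α : G →ₜ* PUH H) : (pullbackExtension α).IsLie n := by
  obtain ⟨V, hV⟩ := (pullbackExtension α).exists_scalarIrrep (lift α) fun _ => rfl
  exact CircleExtension.isLie_of_scalarIrrep hV

theorem CircleExtension.IsLie.secondCountableTopology {n : ℕ}
    [ChartedSpace (EuclideanSpace ℝ (Fin n)) G] [CompactSpace G] {X : CircleExtension.{u, w} G}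
    (hX : X.IsLie n) : SecondCountableTopology X.E := by
  obtain ⟨m, cs, -⟩ := hX
  exact ChartedSpace.secondCountable_of_sigmaCompact (EuclideanSpace ℝ (Fin m)) X.E

end Main

end ProjUnitary
end

theorem mainTheorem5
    (n : ℕ) (G : Type u) [Group G] [TopologicalSpace G]
    [ChartedSpace (EuclideanSpace ℝ (Fin n)) G] [LieGroup (𝓡 n) ∞ G]
    [IsTopologicalGroup G] [T2Space G] [CompactSpace G]
    (H : Type v) [NormedAddCommGroup H] [InnerProductSpace ℂ H] [CompleteSpace H]
    [TopologicalSpace.SeparableSpace H] [Nontrivial H]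
    (hH : ¬ FiniteDimensional ℂ H) :
    ∃ Φ : ProjUnitary.StableClasses G H ≃ ProjUnitary.ExtClasses.{u, max u v} n G,
      ∀ α : ProjUnitary.StableHom G H,
        ∃ hLie : (ProjUnitary.pullbackExtension α.1).IsLie n,
          Φ (ProjUnitary.conjClass α) =
            ProjUnitary.extClass n (ProjUnitary.pullbackExtension α.1) hLie := by
  open ProjUnitary in
  let φ : StableClasses G H → ExtClasses.{u, max u v} n G :=
    Quotient.lift (fun α : StableHom G H =>
      extClass n (pullbackExtension α.1) (isLie_pullbackExtension α.1)) (by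
        rintro α β ⟨F, hF⟩
        exact Quotient.sound (pullbackExtension_iso_of_conj F hF))
  have hφ : Function.Bijective φ := by
    constructor
    · rintro ⟨α⟩ ⟨β⟩ h
      exact Quotient.sound
        (ProjUnitary.conj_of_pullbackExtension_iso α.2 β.2 (Quotient.exact h))
    · rintro ⟨X, hX⟩
      -- A compact manifold is second countable, which makes L²(X; H) separable and so lets its
      -- weight-one part be identified with H.
      have := hX.secondCountableTopology
      obtain ⟨α, hα, hiso⟩ := X.exists_stable hH
      exact ⟨ProjUnitary.conjClass ⟨α, hα⟩,
        Quotient.sound (ProjUnitary.CircleExtension.Iso.equivalence.symm hiso)⟩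
  exact ⟨Equiv.ofBijective φ hφ, fun α => ⟨ProjUnitary.isLie_pullbackExtension α.1, rfl⟩⟩
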